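/- Let $\epsilon\in[0,1]$ and consider the binary erasure channel with input alphabet $\{0,1\}$, output alphabet $\{0,1,?\}$ and transition probabilities $p(?\mid x)=\epsilon$, $p(x\mid x)=1-\epsilon$. A code with feedback of length $n$ and rate $R\ge 0$ has $\lceil 2^{nR}\rceil$ messages, encoding functions $x_i=f_i(m,y^{i-1})\in\{0,1\}$, $1\le i\le n$, satisfying the $(1,\infty)$-RLL constraint ($f_i(m,y^{i-1})=0$ whenever $f_{i-1}(m,y^{i-2})=1$, for all $m$ and $y^{i-1}$), and a decoding function $\Psi$ from $\{0,1,?\}^n$ to the messages. The rate $R$ is achievable if there are such codes, one for each $n$, whose average error probability (uniform message) tends to $0$ as $n\to\infty$. The feedback capacity $C^{\mathrm{fb}}_\epsilon$ is the supremum of the achievable rates. **Capacity.** The set of achievable rates is bounded and $$C^{\mathrm{fb}}_\epsilon=\max_{0\le p\le 1/2}\frac{H_b(p)}{p+\frac1{1-\epsilon}},\qquad H_b(p)=-p\log_2p-(1-p)\log_2(1-p),$$ where for $\epsilon=1$ the right-hand side is read as $0$. **Coding scheme.** For $p\in[0,\frac12]$, $l\in\mathbb N$ and a number $M$ of messages,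 consider the following procedure, which the decoder can follow from the channel outputs. At the start all messages are possible. At each stage the set $S$ of possible messages is expanded to the points $0,\frac1{|S|},\dots,\frac{|S|-1}{|S|}$ of the unit interval, in increasing order. * While $|S|>2^l$ and $|S|>1$: label $[1-p,1)$ by $1$ and the rest of $[0,1)$ by $0$, and transmit the label of the message. As long as erasures are received, exchange the labels of $[(1-p)(1-q),1-p)$ and $[1-p,1)$, where $q=\frac p{1-p}$, and transmit the new label of the message. When a bit is received, replace $S$ by the set of those messages in $S$ whose current label is that bit; if the bit was $1$, also transmit an additional $0$, whose output is ignored. * While $1<|S|\le 2^l$: transmit the label of the message, which is $1$ on $[\frac12,1)$ and $0$ on $[0,\frac12)$, followed by a $0$ whose output is ignored; if the first symbol of the pair was not erased, replace $S$ by the set of messages in $S$ with the received label. * When $|S|\le 1$, stop and decode to the message in $S$ (afterwards only zeros are transmitted). Let $T$ be the number of channel uses until the procedure stops, for a uniformly distributed message. Then: 1. The encoding functions of this procedure satisfy the $(1,\infty)$-RLL constraint, for all $p\in[0,\frac12]$, $l$ and $M$. 2. The scheme has zero error, for all $p\in[0,\frac12]$, $l$ and $M\ge1$: for every message and every output sequence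 of positive probability given that message after which the procedure has stopped, the decoded message is the transmitted one. 3. Let $\epsilon<1$ and let $p\in[0,\frac12]$ be a maximizer of $H_b(p)/(p+\frac1{1-\epsilon})$ on $[0,\frac12]$. Then for every $\delta>0$ there is $l_0$ such that for all $l\ge l_0$: $\mathbb E[T]<\infty$ for every $M$, and $\left|\frac{\log_2M}{\mathbb E[T]}-C^{\mathrm{fb}}_\epsilon\right|<\delta$ for all sufficiently large $M$. Moreover, for every $0\le R<C^{\mathrm{fb}}_\epsilon$ there is $l_0$ such that for all $l\ge l_0$ the codes obtained from the scheme with $M=\lceil 2^{nR}\rceil$ by stopping it after $n$ channel uses (if it is not over by then, the decoder outputs the least message in $S$ if $S\neq\emptyset$, and an arbitrary fixed message otherwise) have average error probability tending to $0$ as $n\to\infty$. -/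

import Mathlib

open Set Filter Topology

noncomputable section

namespace ErasureRLL

/-- Channel outputs: `some b` is the received bit `b`, and `none` is the erasure symbol `?`. -/
abbrev Output : Type := Option Bool

/-- Transition probabilities `p(y | x)` of the binary erasure channel with erasure probability
`ε`. The input bits `0`, `1` are `false`, `true`. -/
def channel (ε : ℝ) (x : Bool) : Output → ℝ
  | none => ε
  | some b => if b = x then 1 - ε else 0

/-- The first `i` outputs of a block of `n` outputs. -/
def outputPrefix {n : ℕ} (y : Fin n → Output) (i : ℕ) (hi : i ≤ n) : Fin i → Output :=
  fun j => y (Fin.castLE hi j)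

/-- Encoding functions with feedback: the input at time `i` (counted from `0`) is a function of
the message and of the `i` previous outputs. -/
abbrev Encoder (n M : ℕ) : Type := (i : Fin n) → Fin M → (Fin i → Output) → Bool

/-- The `(1,∞)`-RLL constraint: after a one, the next input is a zero, for every message and
every output sequence. -/
def IsRLL {n M : ℕ} (f : Encoder n M) : Prop :=
  ∀ (m : Fin M) (y : Fin n → Output) (i : ℕ) (hi : i + 1 < n),
    f ⟨i, Nat.lt_of_succ_lt hi⟩ m (outputPrefix y i (Nat.lt_of_succ_lt hi).le) = true →
      f ⟨i + 1, hi⟩ m (outputPrefix y (i + 1) hi.le) = false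

/-- The probability `p(y | m)` of the output block `y` when the message is `m`: the channel is
memoryless and is used with the inputs that the encoder chooses. -/
def law (ε : ℝ) {n M : ℕ} (f : Encoder n M) (m : Fin M) (y : Fin n → Output) : ℝ :=
  ∏ i : Fin n, channel ε (f i m (outputPrefix y i i.isLt.le)) (y i)

/-- An encoder and a decoding function, of block length `n` and with `M` messages. -/
structure Code (n M : ℕ) where
  enc : Encoder n M
  dec : (Fin n → Output) → Fin M

/-- Average probability of error, for a uniformly distributed message. -/
def errorProb (ε : ℝ) {n M : ℕ} (c : Code n M) : ℝ :=
  (∑ m : Fin M, ∑ y : Fin n → Output, if c.dec y = m then 0 else law ε c.enc m y) / M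

/-- The number of messages `2 ^ (n R)`, rounded up to an integer. -/
def numMessages (n : ℕ) (R : ℝ) : ℕ := ⌈(2 : ℝ) ^ ((n : ℝ) * R)⌉₊

instance (n : ℕ) (R : ℝ) : NeZero (numMessages n R) :=
  ⟨(Nat.ceil_pos.mpr (Real.rpow_pos_of_pos two_pos _)).ne'⟩

/-- `R` is achievable: there are constrained codes with `2 ^ (n R)` messages, one for each block
length `n`, whose probability of error tends to zero. -/
def Achievable (ε R : ℝ) : Prop :=
  0 ≤ R ∧ ∃ c : (n : ℕ) → Code n (numMessages n R),
    (∀ n, IsRLL (c n).enc) ∧ Tendsto (fun n => errorProb ε (c n)) atTop (𝓝 0)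

/-- The feedback capacity: the supremum of the achievable rates. -/
def feedbackCapacity (ε : ℝ) : ℝ := sSup {R | Achievable ε R}

/-- The binary entropy function, in bits. -/
def binEntropy₂ (p : ℝ) : ℝ := Real.binEntropy p / Real.log 2

/-- `H_b(p) / (p + 1 / (1 - ε))`; for `ε = 1` the denominator is infinite and the value is `0`. -/
def rateFun (ε p : ℝ) : ℝ :=
  if ε = 1 then 0 else binEntropy₂ p / (p + 1 / (1 - ε))

/-! ### The coding scheme -/

/-- Ways to label the unit interval. -/
inductive Labelling
  | first
  | second
  | half

/-- The sub-interval that is labelled `1`, the rest of the unit interval being labelled `0`.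
With `q = p / (1 - p)`, the labelling `first` is `[1 - p, 1)` and the labelling `second` is
`[(1 - p)(1 - q), 1 - p)`. Under `half` the label is the first binary digit. -/
def oneInterval (p : ℝ) : Labelling → Set ℝ
  | .first => Ico (1 - p) 1
  | .second => Ico ((1 - p) * (1 - p / (1 - p))) (1 - p)
  | .half => Ico (1 / 2) 1

/-- The place of a message when the set `S` is expanded uniformly to the unit interval: the
elements of `S`, in increasing order, are at `0, 1/|S|, 2/|S|, …, (|S| - 1)/|S|`. -/
def position {M : ℕ} (S : Finset (Fin M)) (m : Fin M) : ℝ :=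
  ((S.filter fun j => j < m).card : ℝ) / (S.card : ℝ)

open Classical in
/-- The messages of `S` that lie in the sub-interval labelled `1`. -/
def ones (p : ℝ) {M : ℕ} (L : Labelling) (S : Finset (Fin M)) : Finset (Fin M) :=
  S.filter fun m => position S m ∈ oneInterval p L

/-- The messages of `S` that lie in the part labelled `0`. -/
def zeros (p : ℝ) {M : ℕ} (L : Labelling) (S : Finset (Fin M)) : Finset (Fin M) :=
  S \ ones p L S

/-- What the scheme does next: `send` transmits the label of the message under one of the two
alternating labellings, `pair` transmits one binary digit of the message as the first symbol of a
pair, `zero` transmits the zero that follows, and `done` means that the procedure is over. -/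
inductive Phase
  | send1
  | send2
  | pair
  | zero
  | done
  deriving DecidableEq

/-- The state shared by the encoder and the decoder, computed from the outputs. -/
structure State (M : ℕ) where
  possible : Finset (Fin M)
  phase : Phase

/-- Begin a new round with the set `S` of possible messages: interval labelling as long as `S` has
more than `2 ^ l` elements, then digit by digit, until only one message is left. -/
def begin (l : ℕ) {M : ℕ} (S : Finset (Fin M)) : State M :=
  ⟨S, if S.card ≤ 1 then .done else if S.card ≤ 2 ^ l then .pair else .send1⟩

/-- Update of the state by an output symbol. -/
def step (p : ℝ) (l : ℕ) {M : ℕ} (s : State M) (y : Output) : State M :=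
  match s.phase, y with
  | .send1, none => ⟨s.possible, .send2⟩
  | .send1, some false => begin l (zeros p .first s.possible)
  | .send1, some true => ⟨ones p .first s.possible, .zero⟩
  | .send2, none => ⟨s.possible, .send1⟩
  | .send2, some false => begin l (zeros p .second s.possible)
  | .send2, some true => ⟨ones p .second s.possible, .zero⟩
  | .pair, none => ⟨s.possible, .zero⟩
  | .pair, some false => ⟨zeros p .half s.possible, .zero⟩
  | .pair, some true => ⟨ones p .half s.possible, .zero⟩
  | .zero, _ => begin l s.possible
  | .done, _ => s

/-- The state after the outputs `y` have been received, starting with all messages possible. -/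
def run (p : ℝ) (l M : ℕ) {n : ℕ} (y : Fin n → Output) : State M :=
  (List.ofFn y).foldl (step p l) (begin l Finset.univ)

/-- The symbol that is transmitted in a given state for the message `m`. -/
def emit (p : ℝ) {M : ℕ} (s : State M) (m : Fin M) : Bool :=
  match s.phase with
  | .send1 => decide (m ∈ ones p .first s.possible)
  | .send2 => decide (m ∈ ones p .second s.possible)
  | .pair => decide (m ∈ ones p .half s.possible)
  | .zero => false
  | .done => false

/-- The first `n` encoding functions of the scheme (zeros are sent when it is over). -/
def schemeEnc (p : ℝ) (l M n : ℕ) : Encoder n M :=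
  fun _ m y => emit p (run p l M y) m

/-- The decoder's output: the least possible message, which is the only one when the scheme is
over. -/
def schemeDec (p : ℝ) (l M : ℕ) [NeZero M] {n : ℕ} (y : Fin n → Output) : Fin M :=
  if h : (run p l M y).possible.Nonempty then (run p l M y).possible.min' h else 0

/-- The scheme, cut off after `n` channel uses. -/
def schemeCode (p : ℝ) (l M : ℕ) [NeZero M] (n : ℕ) : Code n M :=
  ⟨schemeEnc p l M n, schemeDec p l M⟩

/-- The probability that the scheme, for a uniformly distributed message, is not yet over after
`n` channel uses. -/
def runningProb (ε p : ℝ) (l M n : ℕ) : ℝ :=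
  (∑ m : Fin M, ∑ y : Fin n → Output,
    if (run p l M y).phase = .done then 0 else law ε (schemeEnc p l M n) m y) / M

/-- The expected number `𝔼[T]` of channel uses until the scheme is over, computed as
`∑ₙ Pr(T > n)`; it is infinite if the scheme has a positive probability to go on for ever. -/
def expectedUses (ε p : ℝ) (l M : ℕ) : ENNReal :=
  ∑' n : ℕ, ENNReal.ofReal (runningProb ε p l M n)

end ErasureRLL

end

/-! The channel never flips a bit, so given the outputs `y` all messages in `compat e y` are equally
likely, and every expectation is a sum of `weight ε y` times a function of the compatible set
(`sum_law_mul`). Claims about n channel uses thus reduce to one-step inequalities for a potential of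
this set. If b of s compatible messages send a one, a received bit gains H(b/s) nats on average
(`card_mul_log_sub`), and a received one forces a useless zero. Price a channel use at r nats: one
use balances when (1-ε)(H(a) - a r) ≤ r, and this holds for all fractions a exactly when r is at
least the maximum of the rate function, in nats (`reward_le_of_isMaxOn`).

Converse: for such r the remaining information, suitably corrected for forced zeros, falls by at
most r per use (`potential_step`), while a code with few errors must bring it from log M almost to
zero (`one_sub_errorProb_mul_log_le`).

Scheme: both alternating labellings give a fraction of about p of ones, and their one-intervals are
disjoint, so a use after an erasure has nearly the same gain without violating the constraint. For r
below capacity and small θ > 0, the mean of |S|^θ shrinks by e^{-θr} per use, a Chernoff bound P(T >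
n) ≤ D^l M^θ e^{-θrn} (`runningProb_le`, `exists_runningProb_le`). It controls the errors of the
cut-off codes and gives E[T] ≤ log M / r + O(1). The matching lower bound on E[T] comes from the
drift of log|S| (`log_le_runningProb`). The parameter l serves only to make rounding of the fraction
p harmless; the short final sets cost a factor D^l independent of M. -/

namespace ErasureRLL

/-! ### Laws of the outputs as weighted sets of compatible messages -/

section

/-- The truncation to block length `n` of a family of encoding functions for all times. -/
def truncate {M : ℕ} (e : (i : ℕ) → Fin M → (Fin i → Output) → Bool) (n : ℕ) : Encoder n M :=
  fun i => e i

/-- The messages that are compatible with the outputs `y`. -/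
def compat {M : ℕ} (e : (i : ℕ) → Fin M → (Fin i → Output) → Bool) {n : ℕ}
    (y : Fin n → Output) : Finset (Fin M) :=
  Finset.univ.filter fun m => ∀ i : Fin n,
    y i = none ∨ y i = some (e i m (outputPrefix y i i.isLt.le))

/-- The probability of the erasure pattern of `y`. -/
noncomputable def weight (ε : ℝ) {n : ℕ} (y : Fin n → Output) : ℝ :=
  ∏ i : Fin n, if y i = none then ε else 1 - ε

variable {M : ℕ} {e : (i : ℕ) → Fin M → (Fin i → Output) → Bool}

/-- The likelihood takes only two values: zero, and the weight of the erasure pattern, which does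
not depend on the message. -/
lemma law_truncate (ε : ℝ) {n : ℕ} (m : Fin M) (y : Fin n → Output) :
    law ε (truncate e n) m y = if m ∈ compat e y then weight ε y else 0 := by
  unfold law weight
  split_ifs with h
  · simp only [compat, Finset.mem_filter, Finset.mem_univ, true_and] at h
    refine Finset.prod_congr rfl fun i _ => ?_
    rcases h i with h | h <;> simp [h, channel, truncate]
  · simp only [compat, Finset.mem_filter, Finset.mem_univ, true_and, not_forall, not_or] at h
    obtain ⟨i, h1, h2⟩ := h
    refine Finset.prod_eq_zero (Finset.mem_univ i) ?_
    obtain ⟨b, hb⟩ := Option.ne_none_iff_exists'.mp h1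
    rw [hb] at h2 ⊢
    simp only [channel, truncate]
    exact if_neg fun hc => h2 (congrArg some hc)

lemma weight_nonneg {ε : ℝ} (hε : ε ∈ Icc (0 : ℝ) 1) {n : ℕ} (y : Fin n → Output) :
    0 ≤ weight ε y := by
  refine Finset.prod_nonneg fun i _ => ?_
  split_ifs
  · exact hε.1
  · linarith [hε.2]

lemma outputPrefix_snoc {n : ℕ} (y : Fin n → Output) (o : Output) (i : ℕ) (hi : i ≤ n) :
    outputPrefix (Fin.snoc y o : Fin (n + 1) → Output) i (hi.trans n.le_succ) =
      outputPrefix y i hi := by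
  funext j
  have : Fin.castLE (hi.trans n.le_succ) j = Fin.castSucc (Fin.castLE hi j) := rfl
  simp only [outputPrefix]
  rw [this]
  exact Fin.snoc_castSucc (α := fun _ => Output) _ _ _

lemma compat_snoc {n : ℕ} (y : Fin n → Output) (o : Output) :
    compat e (Fin.snoc y o : Fin (n + 1) → Output) =
      (compat e y).filter fun m => o = none ∨ o = some (e n m y) := by
  ext m
  simp only [compat, Finset.mem_filter, Finset.mem_univ, true_and, Fin.forall_fin_succ']
  refine and_congr (forall_congr' fun i => ?_) ?_
  · have h := outputPrefix_snoc y o i i.isLt.le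
    simp only [Fin.snoc_castSucc, Fin.val_castSucc]
    rw [h]
  · have h := outputPrefix_snoc y o n le_rfl
    simp only [Fin.snoc_last, Fin.val_last]
    rw [h]
    rfl

lemma compat_snoc_none {n : ℕ} (y : Fin n → Output) :
    compat e (Fin.snoc y none : Fin (n + 1) → Output) = compat e y := by
  simp [compat_snoc]

lemma compat_snoc_true {n : ℕ} (y : Fin n → Output) :
    compat e (Fin.snoc y (some true) : Fin (n + 1) → Output) =
      (compat e y).filter fun m => e n m y = true := by
  rw [compat_snoc]; congr 1; ext m; cases e n m y <;> simp

lemma compat_snoc_false {n : ℕ} (y : Fin n → Output) :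
    compat e (Fin.snoc y (some false) : Fin (n + 1) → Output) =
      compat e y \ (compat e y).filter fun m => e n m y = true := by
  rw [compat_snoc]; ext m
  simp only [Finset.mem_filter, Finset.mem_sdiff]
  cases e n m y <;> simp

lemma compat_zero (y : Fin 0 → Output) : compat e y = Finset.univ := by
  simp [compat]

lemma sum_weight_succ (ε : ℝ) {n : ℕ} (U : (Fin (n + 1) → Output) → ℝ) :
    ∑ y, weight ε y * U y = ∑ y : Fin n → Output, weight ε y *
      (ε * U (Fin.snoc y none) + (1 - ε) * (U (Fin.snoc y (some true)) +
        U (Fin.snoc y (some false)))) := by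
  have hw : ∀ (y : Fin n → Output) (o : Output), weight ε (Fin.snoc y o : Fin (n + 1) → Output) =
      weight ε y * if o = none then ε else 1 - ε := by
    intro y o
    simp [weight, Fin.prod_univ_castSucc]
  rw [← (Fin.snocEquiv fun _ : Fin (n + 1) => Output).sum_comp, Fintype.sum_prod_type_right]
  refine Finset.sum_congr rfl fun y _ => ?_
  simp only [Fin.snocEquiv, Equiv.coe_fn_mk, hw, Fintype.sum_option, Fintype.sum_bool]
  simp
  ring

/-- A sum over messages and outputs that is weighted by the law of the outputs. -/
lemma sum_law_mul (ε : ℝ) {n : ℕ} (F : Fin M → (Fin n → Output) → ℝ) :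
    ∑ m, ∑ y, law ε (truncate e n) m y * F m y =
      ∑ y, weight ε y * ∑ m ∈ compat e y, F m y := by
  rw [Finset.sum_comm]
  refine Finset.sum_congr rfl fun y _ => ?_
  rw [Finset.mul_sum, ← Finset.sum_filter_add_sum_filter_not _ (· ∈ compat e y)]
  rw [Finset.filter_mem_eq_inter, Finset.univ_inter]
  rw [Finset.sum_congr rfl fun m hm => by rw [law_truncate, if_pos hm], add_eq_left]
  refine Finset.sum_eq_zero fun m hm => ?_
  rw [law_truncate, if_neg (Finset.mem_filter.1 hm).2, zero_mul]

/-- Drift argument: a bound on the expected change of a potential in one channel use. -/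
lemma sum_weight_le_succ {ε : ℝ} (hε : ε ∈ Icc (0 : ℝ) 1) {n : ℕ} (V : (Fin n → Output) → ℝ)
    (U : (Fin (n + 1) → Output) → ℝ)
    (h : ∀ y, V y ≤ ε * U (Fin.snoc y none) + (1 - ε) * (U (Fin.snoc y (some true)) +
        U (Fin.snoc y (some false)))) :
    ∑ y, weight ε y * V y ≤ ∑ y, weight ε y * U y := by
  rw [sum_weight_succ]
  exact Finset.sum_le_sum fun y _ => mul_le_mul_of_nonneg_left (h y) (weight_nonneg hε y)

lemma sum_weight_succ_le {ε : ℝ} (hε : ε ∈ Icc (0 : ℝ) 1) {n : ℕ} (V : (Fin n → Output) → ℝ)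
    (U : (Fin (n + 1) → Output) → ℝ)
    (h : ∀ y, ε * U (Fin.snoc y none) + (1 - ε) * (U (Fin.snoc y (some true)) +
        U (Fin.snoc y (some false))) ≤ V y) :
    ∑ y, weight ε y * U y ≤ ∑ y, weight ε y * V y := by
  rw [sum_weight_succ]
  exact Finset.sum_le_sum fun y _ => mul_le_mul_of_nonneg_left (h y) (weight_nonneg hε y)

lemma card_compat_snoc_add {n : ℕ} (y : Fin n → Output) :
    ((compat e (Fin.snoc y (some true) : Fin (n + 1) → Output)).card : ℝ) +
      (compat e (Fin.snoc y (some false) : Fin (n + 1) → Output)).card = (compat e y).card := by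
  rw [compat_snoc_true, compat_snoc_false, ← Nat.cast_add, add_comm,
    Finset.card_sdiff_add_card_eq_card (Finset.filter_subset _ _)]

/-- Total probability, summed over the messages. The weights alone do not sum to one, since each
received bit may have two values; the number of compatible messages restores the normalisation. -/
lemma sum_weight_card_compat (ε : ℝ) (n : ℕ) :
    ∑ y : Fin n → Output, weight ε y * (compat e y).card = M := by
  induction n with
  | zero => simp [weight, compat_zero]
  | succ n ih =>
    rw [sum_weight_succ, ← ih]
    refine Finset.sum_congr rfl fun y _ => ?_
    rw [card_compat_snoc_add, compat_snoc_none]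
    ring

/-- The grouping property of the entropy, for a set of `s` elements and a subset of `b`. -/
lemma card_mul_log_sub {s b c : ℕ} (h : b + c = s) :
    (b : ℝ) * Real.log b + c * Real.log c =
      s * Real.log s - s * Real.binEntropy (b / s) := by
  subst h
  rcases Nat.eq_zero_or_pos b with rfl | hb
  · simp
  rcases Nat.eq_zero_or_pos c with rfl | hc
  · simp [hb.ne']
  have hb' : (0 : ℝ) < b := by exact_mod_cast hb
  have hc' : (0 : ℝ) < c := by exact_mod_cast hc
  have h1 : 1 - (b : ℝ) / ((b + c : ℕ) : ℝ) = c / (b + c) := by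
    push_cast; field_simp; ring
  rw [Real.binEntropy, h1]
  push_cast
  rw [inv_div, inv_div, Real.log_div (by positivity) (by positivity),
    Real.log_div (by positivity) (by positivity)]
  field_simp
  ring

end

/-! ### The converse -/

section

/-- The expected reward of one channel use, when a fraction `a` of the possible messages sends a
one and a one costs `r`. Information is measured in nats. -/
noncomputable def reward (ε r a : ℝ) : ℝ := (1 - ε) * (Real.binEntropy a - a * r)

/-- The largest reward of a fraction of at most `t`. -/
noncomputable def maxReward (ε r t : ℝ) : ℝ := sSup (reward ε r '' Icc 0 t)

lemma maxReward_le {ε r t : ℝ} (h : ∀ a ∈ Icc (0 : ℝ) 1, reward ε r a ≤ r)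
    (ht : t ∈ Icc (0 : ℝ) 1) : maxReward ε r t ≤ r := by
  refine csSup_le ⟨_, mem_image_of_mem _ ⟨le_rfl, ht.1⟩⟩ ?_
  rintro _ ⟨a, ha, rfl⟩
  exact h a ⟨ha.1, ha.2.trans ht.2⟩

lemma le_maxReward {ε r t a : ℝ} (h : ∀ a ∈ Icc (0 : ℝ) 1, reward ε r a ≤ r)
    (ht : t ≤ 1) (ha : a ∈ Icc 0 t) : reward ε r a ≤ maxReward ε r t := by
  refine le_csSup ⟨r, ?_⟩ (mem_image_of_mem _ ha)
  rintro _ ⟨a, ha, rfl⟩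
  exact h a ⟨ha.1, ha.2.trans ht⟩

/-- The value of a set of `s` possible messages, `a` of which have just sent a one. -/
noncomputable def potential (ε r : ℝ) (s a : ℕ) : ℝ :=
  s * Real.log s + s * (r - maxReward ε r (1 - a / s))

lemma one_sub_div_mem {s a : ℕ} (h : a ≤ s) : 1 - (a / s : ℝ) ∈ Icc (0 : ℝ) 1 := by
  have : (a / s : ℝ) ≤ 1 := div_le_one_of_le₀ (by exact_mod_cast h) (by positivity)
  have : 0 ≤ (a / s : ℝ) := by positivity
  constructor <;> linarith

lemma mul_log_le_potential {ε r : ℝ} (h : ∀ a ∈ Icc (0 : ℝ) 1, reward ε r a ≤ r) {s a : ℕ}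
    (ha : a ≤ s) : s * Real.log s ≤ potential ε r s a := by
  have := maxReward_le h (one_sub_div_mem ha)
  have : 0 ≤ s * (r - maxReward ε r (1 - a / s)) := mul_nonneg (by positivity) (by linarith)
  unfold potential
  linarith

lemma reward_zero (ε r : ℝ) : reward ε r 0 = 0 := by simp [reward]

lemma potential_le {ε r : ℝ} (h : ∀ a ∈ Icc (0 : ℝ) 1, reward ε r a ≤ r) {s a : ℕ}
    (ha : a ≤ s) : potential ε r s a ≤ s * Real.log s + s * r := by
  have h1 := one_sub_div_mem ha
  have := le_maxReward h h1.2 ⟨le_rfl, h1.1⟩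
  rw [reward_zero] at this
  unfold potential
  gcongr
  linarith

/-- When all compatible messages have just sent a one, only the fraction zero is allowed next; the
wasted use is credited in full with `r`. -/
lemma mul_log_add_le_potential_self {ε r : ℝ} (s : ℕ) :
    s * Real.log s + s * r ≤ potential ε r s s := by
  rcases Nat.eq_zero_or_pos s with rfl | hs
  · simp [potential]
  · have : (s : ℝ) ≠ 0 := by exact_mod_cast hs.ne'
    simp [potential, this, maxReward, reward_zero]

/-- Here `a` messages sent a one before, `b` send a one now and `c` a zero. Bounding the potentials
on the right below by s log s, b log b + b r and c log c, the grouping property shows that the loss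
against s log s is s times the reward of b/s, and `a + b ≤ s` puts b/s in the range of `maxReward`.
-/
lemma potential_step {ε r : ℝ} (hε : ε ∈ Icc (0 : ℝ) 1)
    (h : ∀ a ∈ Icc (0 : ℝ) 1, reward ε r a ≤ r) {s a b c : ℕ} (hs : b + c = s) (hab : a + b ≤ s) :
    potential ε r s a - r * s ≤
      ε * potential ε r s b + (1 - ε) * (potential ε r b b + potential ε r c 0) := by
  have hε' : 0 ≤ 1 - ε := by linarith [hε.2]
  have h1 := mul_le_mul_of_nonneg_left (mul_log_le_potential h (show b ≤ s by omega)) hε.1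
  have h2 := mul_le_mul_of_nonneg_left (mul_log_add_le_potential_self (ε := ε) (r := r) b) hε'
  have h3 := mul_le_mul_of_nonneg_left (mul_log_le_potential h (Nat.zero_le c)) hε'
  have h4 := card_mul_log_sub hs
  have h5 : (s : ℝ) * reward ε r (b / s) =
      (1 - ε) * (s * Real.binEntropy (b / s) - b * r) := by
    rcases Nat.eq_zero_or_pos s with rfl | hs0
    · obtain rfl : b = 0 := by omega
      simp
    · have : (s : ℝ) ≠ 0 := by exact_mod_cast hs0.ne'
      rw [reward]; field_simp
  have h6 : (s : ℝ) * reward ε r (b / s) ≤ s * maxReward ε r (1 - a / s) := by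
    rcases Nat.eq_zero_or_pos s with rfl | hs0
    · simp
    · have hs' : (0 : ℝ) < s := by exact_mod_cast hs0
      refine mul_le_mul_of_nonneg_left (le_maxReward h (one_sub_div_mem (by omega)).2
        ⟨by positivity, ?_⟩) hs'.le
      rw [le_sub_iff_add_le, ← add_div]
      refine div_le_one_of_le₀ ?_ hs'.le
      rw [add_comm]
      exact_mod_cast hab
  have h7 : (1 - ε) * (b * Real.log b + c * Real.log c) =
    (1 - ε) * (s * Real.log s - s * Real.binEntropy (b / s)) := by rw [h4]
  have : potential ε r s a - r * s = s * Real.log s - s * maxReward ε r (1 - a / s) := by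
    rw [potential]; ring
  rw [this]
  linarith

variable {M : ℕ} {e : (i : ℕ) → Fin M → (Fin i → Output) → Bool}

/-- The compatible messages that sent a one in the last channel use. -/
def lastOnes (e : (i : ℕ) → Fin M → (Fin i → Output) → Bool) :
    {n : ℕ} → (Fin n → Output) → Finset (Fin M)
  | 0, _ => ∅
  | n + 1, y => (compat e y).filter fun m => e n m (Fin.init y) = true

lemma lastOnes_subset {n : ℕ} (y : Fin n → Output) : lastOnes e y ⊆ compat e y := by
  cases n with
  | zero => simp [lastOnes]
  | succ n => exact Finset.filter_subset _ _

/-- The constraint, for encoding functions for all times. -/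
def IsRLLStream (e : (i : ℕ) → Fin M → (Fin i → Output) → Bool) : Prop :=
  ∀ (n : ℕ) (m : Fin M) (y : Fin n → Output) (o : Output),
    e n m y = true → e (n + 1) m (Fin.snoc y o) = false

lemma disjoint_lastOnes (he : IsRLLStream e) {n : ℕ} (y : Fin n → Output) :
    Disjoint (lastOnes e y) ((compat e y).filter fun m => e n m y = true) := by
  cases n with
  | zero => simp [lastOnes]
  | succ n =>
    refine Finset.disjoint_left.2 fun m h1 h2 => ?_
    have := he n m (Fin.init y) (y (Fin.last n)) (Finset.mem_filter.1 h1).2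
    rw [Fin.snoc_init_self] at this
    simp [this] at h2

/-- Each use loses at most `r` per compatible message, which totals `r * M` by
`sum_weight_card_compat`. -/
lemma potential_drift {ε r : ℝ} (hε : ε ∈ Icc (0 : ℝ) 1)
    (h : ∀ a ∈ Icc (0 : ℝ) 1, reward ε r a ≤ r) (he : IsRLLStream e) (n : ℕ) :
    M * Real.log M - n * r * M ≤ ∑ y : Fin n → Output, weight ε y *
      potential ε r (compat e y).card (lastOnes e y).card := by
  induction n with
  | zero =>
    simpa [weight, compat_zero, lastOnes] using mul_log_le_potential h (Nat.zero_le M)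
  | succ n ih =>
    refine le_trans ?_ (sum_weight_le_succ hε (fun y : Fin n → Output =>
      potential ε r (compat e y).card (lastOnes e y).card - r * (compat e y).card) _ ?_)
    · simp only [mul_sub, Finset.sum_sub_distrib, mul_left_comm _ r]
      rw [← Finset.mul_sum, sum_weight_card_compat]
      push_cast
      linarith
    · intro y
      set B := (compat e y).filter fun m => e n m y = true with hB
      have h0 : lastOnes e (Fin.snoc y none : Fin (n + 1) → Output) = B := by
        simp [lastOnes, compat_snoc_none, hB]
      have h1 : lastOnes e (Fin.snoc y (some true) : Fin (n + 1) → Output) = B := by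
        simp [lastOnes, compat_snoc_true, hB, Finset.filter_filter]
      -- Messages compatible with a received zero have sent a zero.
      have h2 : lastOnes e (Fin.snoc y (some false) : Fin (n + 1) → Output) = ∅ := by
        simp only [lastOnes, compat_snoc_false, Fin.init_snoc]
        ext m
        simp only [Finset.mem_filter, Finset.mem_sdiff]
        simp
        tauto
      rw [h0, h1, h2, compat_snoc_none, compat_snoc_true, compat_snoc_false, ← hB,
        Finset.card_empty]
      refine potential_step hε h ?_ ?_
      · rw [add_comm, Finset.card_sdiff_add_card_eq_card (Finset.filter_subset _ _)]
      · rw [← Finset.card_union_of_disjoint (disjoint_lastOnes he y)]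
        exact Finset.card_le_card
          (Finset.union_subset (lastOnes_subset y) (Finset.filter_subset _ _))

/-- The encoding functions of a code of length `n`, followed by zeros. -/
def extend {n : ℕ} (f : Encoder n M) : (i : ℕ) → Fin M → (Fin i → Output) → Bool :=
  fun i m y => if h : i < n then f ⟨i, h⟩ m y else false

lemma truncate_extend {n : ℕ} (f : Encoder n M) : truncate (extend f) n = f := by
  funext i m y
  simp [truncate, extend]

lemma isRLLStream_extend {n : ℕ} {f : Encoder n M} (hf : IsRLL f) : IsRLLStream (extend f) := by
  intro k m y o h
  unfold extend at h ⊢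
  split_ifs with hk
  · rw [dif_pos (by omega)] at h
    -- The constraint on a code speaks of blocks of full length, so the prefix is padded; the
    -- erasures are an arbitrary choice.
    let Y : Fin n → Output := fun j =>
      if h : (j : ℕ) < k + 1 then (Fin.snoc y o : Fin (k + 1) → Output) ⟨j, h⟩ else none
    have h1 : outputPrefix Y (k + 1) hk.le = Fin.snoc y o := by
      funext j
      simp [outputPrefix, Y, Nat.not_lt.2 (Nat.lt_succ_iff.1 j.isLt)]
    have h2 : outputPrefix Y k (Nat.lt_of_succ_lt hk).le = y := by
      funext j
      have := congrFun h1 (Fin.castSucc j)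
      rw [Fin.snoc_castSucc] at this
      exact this
    have := hf m Y k hk
    rw [h1, h2] at this
    exact this h
  · rfl

/-- This plays the role of Fano's inequality: the guess `d` is wrong for at least s - 1 of the s
messages, and s ≤ 2(s - 1) once s ≥ 2. For s ≤ 1 the left side vanishes. -/
lemma card_mul_log_le (S : Finset (Fin M)) (d : Fin M) :
    (S.card : ℝ) * Real.log S.card ≤
      2 * Real.log M * ∑ m ∈ S, if d = m then (0 : ℝ) else 1 := by
  have hlogM : 0 ≤ Real.log M := Real.log_natCast_nonneg M
  have hsum : ∑ m ∈ S, (if d = m then (0 : ℝ) else 1) = (S.filter fun m => ¬ d = m).card := by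
    rw [Finset.card_filter]
    push_cast
    exact Finset.sum_congr rfl fun m _ => by split_ifs <;> simp_all
  rw [hsum]
  by_cases hS : S.card ≤ 1
  · have : (S.card : ℝ) * Real.log S.card = 0 := by interval_cases S.card <;> simp
    rw [this]; positivity
  · have h1 : S.card ≤ (S.filter fun m => ¬ d = m).card + 1 := by
      rw [← Finset.card_filter_add_card_filter_not (s := S) (fun m => d = m), add_comm]
      gcongr
      refine Finset.card_le_one.2 fun a ha b hb => ?_
      rw [← (Finset.mem_filter.1 ha).2, ← (Finset.mem_filter.1 hb).2]
    have h2 : (S.card : ℝ) ≤ 2 * (S.filter fun m => ¬ d = m).card := by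
      exact_mod_cast (by omega : S.card ≤ 2 * (S.filter fun m => ¬ d = m).card)
    have h3 : Real.log S.card ≤ Real.log M := by
      refine Real.log_le_log (by exact_mod_cast (by omega : 0 < S.card)) ?_
      exact_mod_cast (Finset.card_le_univ S).trans_eq (Fintype.card_fin M)
    calc _ ≤ (2 * (S.filter fun m => ¬ d = m).card : ℝ) * Real.log M := by gcongr
      _ = _ := by ring

/-- The converse for block length `n`. -/
theorem one_sub_errorProb_mul_log_le {ε r : ℝ} (hε : ε ∈ Icc (0 : ℝ) 1)
    (h : ∀ a ∈ Icc (0 : ℝ) 1, reward ε r a ≤ r) {n : ℕ} (hM : 0 < M) (c : Code n M)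
    (hc : IsRLL c.enc) : (1 - 2 * errorProb ε c) * Real.log M ≤ (n + 1) * r := by
  have hM' : (0 : ℝ) < M := by exact_mod_cast hM
  have h1 := potential_drift hε h (isRLLStream_extend hc) n
  -- The final potential may still contain a credit of `r` per message; this is the extra one in `n
  -- + 1`.
  have h2 : ∑ y : Fin n → Output, weight ε y *
      potential ε r (compat (extend c.enc) y).card (lastOnes (extend c.enc) y).card ≤
      2 * Real.log M * (M * errorProb ε c) + r * M := by
    have h3 : (M : ℝ) * errorProb ε c = ∑ y, weight ε y *
        ∑ m ∈ compat (extend c.enc) y, if c.dec y = m then (0 : ℝ) else 1 := by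
      rw [← sum_law_mul, truncate_extend, errorProb, mul_div_cancel₀ _ hM'.ne']
      simp
    have h6 : r * M = ∑ y : Fin n → Output, r * (weight ε y * (compat (extend c.enc) y).card) := by
      rw [← Finset.mul_sum, sum_weight_card_compat]
    rw [h3, h6, Finset.mul_sum, ← Finset.sum_add_distrib]
    refine Finset.sum_le_sum fun y _ => ?_
    have h4 := (potential_le h (Finset.card_le_card
      (lastOnes_subset (e := extend c.enc) y))).trans
        (add_le_add_left (card_mul_log_le (compat (extend c.enc) y) (c.dec y)) _)
    have h5 := mul_le_mul_of_nonneg_left h4 (weight_nonneg hε y)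
    linarith
  refine le_of_mul_le_mul_right ?_ hM'
  linarith

/-- The converse: no rate above `r` is achievable. -/
theorem Achievable.mul_log_two_le {ε r R : ℝ} (hε : ε ∈ Icc (0 : ℝ) 1)
    (h : ∀ a ∈ Icc (0 : ℝ) 1, reward ε r a ≤ r) (hR : Achievable ε R) :
    R * Real.log 2 ≤ r := by
  obtain ⟨hR0, c, hc, hlim⟩ := hR
  have hlog2 : 0 < Real.log 2 := Real.log_pos one_lt_two
  have h1 : ∀ᶠ n : ℕ in atTop,
      (1 - 2 * errorProb ε (c n)) * (R * Real.log 2) ≤ (1 + 1 / (n : ℝ)) * r := by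
    filter_upwards [hlim.eventually_le_const (show (0 : ℝ) < 1 / 2 by norm_num),
      eventually_gt_atTop 0] with n hn hn0
    have hn' : (0 : ℝ) < n := by exact_mod_cast hn0
    have h2 := one_sub_errorProb_mul_log_le hε h (NeZero.pos _) (c n) (hc n)
    have h3 : (n * R) * Real.log 2 ≤ Real.log (numMessages n R) := by
      rw [← Real.log_rpow two_pos]
      exact Real.log_le_log (by positivity) (Nat.le_ceil _)
    have h4 := (mul_le_mul_of_nonneg_left h3
      (by linarith : 0 ≤ 1 - 2 * errorProb ε (c n))).trans h2
    rw [show (1 + 1 / (n : ℝ)) * r = ((n + 1) * r) / n by field_simp, le_div_iff₀ hn']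
    linarith
  have h2 : Tendsto (fun n : ℕ => (1 - 2 * errorProb ε (c n)) * (R * Real.log 2)) atTop
      (𝓝 ((1 - 2 * 0) * (R * Real.log 2))) := ((hlim.const_mul 2).const_sub 1).mul_const _
  have h3 : Tendsto (fun n : ℕ => (1 + 1 / (n : ℝ)) * r) atTop (𝓝 ((1 + 0) * r)) :=
    (tendsto_one_div_atTop_nhds_zero_nat.const_add 1).mul_const _
  simpa using le_of_tendsto_of_tendsto h2 h3 h1

end

/-! ### The constraint and the zero-error property of the scheme -/

section

/-- The encoding functions of the scheme, for all times. -/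
noncomputable def schemeStream (p : ℝ) (l M : ℕ) : (i : ℕ) → Fin M → (Fin i → Output) → Bool :=
  fun _ m y => emit p (run p l M y) m

lemma truncate_schemeStream (p : ℝ) (l M n : ℕ) :
    truncate (schemeStream p l M) n = schemeEnc p l M n := rfl

lemma run_snoc (p : ℝ) (l M : ℕ) {n : ℕ} (y : Fin n → Output) (o : Output) :
    run p l M (Fin.snoc y o : Fin (n + 1) → Output) = step p l (run p l M y) o := by
  rw [run, List.ofFn_succ']
  simp [run]

lemma run_zero (p : ℝ) (l M : ℕ) (y : Fin 0 → Output) : run p l M y = begin l Finset.univ := by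
  simp [run]

variable {M : ℕ}

lemma ones_subset (p : ℝ) (L : Labelling) (S : Finset (Fin M)) : ones p L S ⊆ S := by
  classical exact Finset.filter_subset _ _

/-- The two intervals meet only at the excluded end 1 - p. So a message whose one was erased sends a
zero under the other labelling. -/
lemma disjoint_ones (p : ℝ) (S : Finset (Fin M)) :
    Disjoint (ones p .first S) (ones p .second S) := by
  refine Finset.disjoint_left.2 fun m h1 h2 => ?_
  simp only [ones, oneInterval, Finset.mem_filter, mem_Ico] at h1 h2
  linarith [h1.2.1, h2.2.2]

lemma emit_subset {p : ℝ} {s : State M} {m : Fin M} (h : emit p s m = true) :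
    m ∈ s.possible := by
  rcases s with ⟨S, _ | _ | _ | _ | _⟩ <;> simp only [emit, decide_eq_true_eq] at h
  any_goals exact ones_subset _ _ _ h
  all_goals simp at h

lemma emit_begin_of_notMem {p : ℝ} {l : ℕ} {S : Finset (Fin M)} {m : Fin M} (h : m ∉ S) :
    emit p (begin l S) m = false := by
  by_contra hc
  exact h (emit_subset (s := begin l S) (by simpa using hc))

/-- After a one the scheme transmits a zero, whatever is received. -/
lemma emit_step (p : ℝ) (l : ℕ) (s : State M) (m : Fin M) (o : Output)
    (h : emit p s m = true) : emit p (step p l s o) m = false := by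
  rcases s with ⟨S, _ | _ | _ | _ | _⟩ <;> simp only [emit, decide_eq_true_eq] at h
  · rcases o with _ | _ | _
    · exact decide_eq_false (Finset.disjoint_left.1 (disjoint_ones p S) h)
    -- This output is impossible for `m`, but the constraint is required for all output sequences;
    -- `m` has left the set, so a zero is sent for it.
    · exact emit_begin_of_notMem (by simp [zeros, h])
    · rfl
  · rcases o with _ | _ | _
    · exact decide_eq_false (Finset.disjoint_right.1 (disjoint_ones p S) h)
    · exact emit_begin_of_notMem (by simp [zeros, h])
    · rfl
  · rcases o with _ | _ | _ <;> rfl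
  all_goals simp at h

theorem isRLL_schemeEnc (p : ℝ) (l M n : ℕ) : IsRLL (schemeEnc p l M n) := by
  intro m y i hi h
  have hy : outputPrefix y (i + 1) hi.le =
      Fin.snoc (outputPrefix y i (Nat.lt_of_succ_lt hi).le) (y ⟨i, Nat.lt_of_succ_lt hi⟩) := by
    funext j
    refine Fin.lastCases ?_ (fun j => ?_) j
    · rw [Fin.snoc_last]; rfl
    · rw [Fin.snoc_castSucc]; rfl
  simp only [schemeEnc] at h ⊢
  rw [hy, run_snoc]
  exact emit_step p l _ m _ h

/-- The possible messages for which a one is transmitted. -/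
noncomputable def sentOnes (p : ℝ) (s : State M) : Finset (Fin M) :=
  match s.phase with
  | .send1 => ones p .first s.possible
  | .send2 => ones p .second s.possible
  | .pair => ones p .half s.possible
  | .zero => ∅
  | .done => ∅

lemma filter_emit (p : ℝ) (s : State M) :
    (s.possible.filter fun m => emit p s m = true) = sentOnes p s := by
  have h : ∀ m, emit p s m = true ↔ m ∈ sentOnes p s := by
    rcases s with ⟨S, _ | _ | _ | _ | _⟩ <;> simp [emit, sentOnes]
  ext m
  rw [Finset.mem_filter, ← h]
  exact ⟨fun h => h.2, fun h => ⟨emit_subset h, h⟩⟩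

/-- The compatible messages are those that the scheme regards as possible, unless no message is
compatible with the outputs. -/
lemma compat_schemeStream (p : ℝ) (l : ℕ) {n : ℕ} (y : Fin n → Output) :
    compat (schemeStream p l M) y = ∅ ∨
      compat (schemeStream p l M) y = (run p l M y).possible := by
  induction n with
  | zero => right; rw [compat_zero, run_zero]; rfl
  | succ n ih =>
    obtain ⟨y, o, rfl⟩ : ∃ (y' : Fin n → Output) (o : Output), y = Fin.snoc y' o :=
      ⟨Fin.init y, y (Fin.last n), (Fin.snoc_init_self y).symm⟩
    rcases ih y with h | h
    · left; rw [compat_snoc, h]; rfl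
    · have hB : ((run p l M y).possible.filter fun m => schemeStream p l M n m y = true) =
        sentOnes p (run p l M y) := filter_emit p _
      rw [run_snoc]
      generalize run p l M y = s at h hB
      rcases o with _ | _ | _
      · right
        rw [compat_snoc_none, h]
        rcases s with ⟨S, _ | _ | _ | _ | _⟩ <;> rfl
      · right
        rw [compat_snoc_false, h, hB]
        rcases s with ⟨S, _ | _ | _ | _ | _⟩
        any_goals rfl
        all_goals exact Finset.sdiff_empty
      · rw [compat_snoc_true, h, hB]
        rcases s with ⟨S, _ | _ | _ | _ | _⟩
        any_goals exact Or.inr rfl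
        -- A one received in the phases `zero` and `done` is impossible: nothing is compatible with
        -- it, while the state ignores its value.
        all_goals exact Or.inl rfl

/-- The relation between the phase and the number of possible messages. -/
def WellFormed (l : ℕ) (s : State M) : Prop :=
  match s.phase with
  | .send1 => 1 < s.possible.card ∧ 2 ^ l < s.possible.card
  | .send2 => 1 < s.possible.card ∧ 2 ^ l < s.possible.card
  | .pair => 1 < s.possible.card ∧ s.possible.card ≤ 2 ^ l
  | .zero => True
  | .done => s.possible.card ≤ 1

lemma wellFormed_begin (l : ℕ) (S : Finset (Fin M)) : WellFormed l (begin l S) := by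
  unfold begin
  split_ifs with h1 h2
  · exact h1
  · exact ⟨not_le.1 h1, h2⟩
  · exact ⟨not_le.1 h1, not_le.1 h2⟩

lemma WellFormed.step {l : ℕ} {s : State M} (h : WellFormed l s) (p : ℝ) (o : Output) :
    WellFormed l (step p l s o) := by
  rcases s with ⟨S, _ | _ | _ | _ | _⟩ <;> rcases o with _ | _ | _
  all_goals first
    | exact h
    | exact wellFormed_begin _ _
    | trivial

lemma wellFormed_run (p : ℝ) (l : ℕ) {n : ℕ} (y : Fin n → Output) :
    WellFormed l (run p l M y) := by
  induction n with
  | zero => rw [run_zero]; exact wellFormed_begin _ _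
  | succ n ih =>
    rw [← Fin.snoc_init_self y, run_snoc]
    exact (ih _).step p _

lemma card_le_one_of_done (p : ℝ) (l : ℕ) {n : ℕ} (y : Fin n → Output)
    (h : (run p l M y).phase = .done) : (run p l M y).possible.card ≤ 1 := by
  have := wellFormed_run (M := M) p l y
  rwa [WellFormed, h] at this

theorem schemeDec_eq_of_done {ε p : ℝ} {l : ℕ} [NeZero M] {n : ℕ} {m : Fin M}
    {y : Fin n → Output} (hlaw : law ε (schemeEnc p l M n) m y ≠ 0)
    (h : (run p l M y).phase = .done) : schemeDec p l M y = m := by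
  have hm : m ∈ (run p l M y).possible := by
    rw [← truncate_schemeStream, law_truncate] at hlaw
    have hmem : m ∈ compat (schemeStream p l M) y := by
      by_contra hc
      exact hlaw (if_neg hc)
    rcases compat_schemeStream (M := M) p l y with h0 | h0
    · simp [h0] at hmem
    · rwa [h0] at hmem
  rw [schemeDec, dif_pos ⟨m, hm⟩]
  exact Finset.card_le_one.1 (card_le_one_of_done p l y h) _ (Finset.min'_mem _ _) _ hm

/-- Errors occur only if the scheme is cut off before it is over. -/
lemma errorProb_le_runningProb {ε : ℝ} (hε : ε ∈ Icc (0 : ℝ) 1) (p : ℝ) (l M : ℕ) [NeZero M]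
    (n : ℕ) : errorProb ε (schemeCode p l M n) ≤ runningProb ε p l M n := by
  unfold errorProb runningProb
  gcongr with m _ y _
  by_cases hlaw : law ε (schemeEnc p l M n) m y = 0
  · have : law ε (schemeCode p l M n).enc m y = 0 := hlaw
    simp [this, hlaw]
  · have hnn : 0 ≤ law ε (schemeEnc p l M n) m y := by
      rw [← truncate_schemeStream, law_truncate]
      split_ifs
      exacts [weight_nonneg hε y, le_rfl]
    by_cases h : (run p l M y).phase = .done
    · have : (schemeCode p l M n).dec y = m := schemeDec_eq_of_done hlaw h
      rw [if_pos this, if_pos h]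
    · rw [if_neg h]
      split_ifs
      exacts [hnn, le_rfl]

lemma mul_runningProb (ε p : ℝ) (l M n : ℕ) (hM : 0 < M) :
    M * runningProb ε p l M n = ∑ y : Fin n → Output, weight ε y *
      ((compat (schemeStream p l M) y).card *
        if (run p l M y).phase = .done then (0 : ℝ) else 1) := by
  have hM' : (M : ℝ) ≠ 0 := by exact_mod_cast hM.ne'
  rw [runningProb, mul_div_cancel₀ _ hM']
  have h := sum_law_mul (M := M) (e := schemeStream p l M) ε (n := n)
    fun _ y => if (run p l M y).phase = .done then (0 : ℝ) else 1
  simp only [Finset.sum_const, nsmul_eq_mul] at h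
  rw [← h]
  simp [truncate_schemeStream]

end

/-! ### The sizes of the labelled sets -/

section

variable {M : ℕ}

lemma injOn_card_filter_lt (S : Finset (Fin M)) :
    InjOn (fun m => (S.filter fun j => j < m).card) S := by
  have h : ∀ a ∈ S, ∀ b : Fin M, a < b →
      (S.filter fun j => j < a).card < (S.filter fun j => j < b).card := by
    intro a ha b hab
    refine Finset.card_lt_card (Finset.ssubset_iff_of_subset ?_ |>.2 ⟨a, by simp [ha, hab], by simp⟩)
    intro j hj
    rw [Finset.mem_filter] at hj ⊢
    exact ⟨hj.1, hj.2.trans hab⟩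
  intro a ha b hb hab
  rcases lt_trichotomy a b with hlt | heq | hlt
  · exact absurd hab (h a ha b hlt).ne
  · exact heq
  · exact absurd hab (h b hb a hlt).ne'

/-- The positions are exactly the k/|S| with k < |S|, so counting messages in an interval means
counting integers. -/
lemma image_card_filter_lt (S : Finset (Fin M)) :
    S.image (fun m => (S.filter fun j => j < m).card) = Finset.range S.card := by
  refine Finset.eq_of_subset_of_card_le ?_ ?_
  · intro k hk
    obtain ⟨m, hm, rfl⟩ := Finset.mem_image.1 hk
    refine Finset.mem_range.2 (Finset.card_lt_card ?_)
    exact (Finset.ssubset_iff_of_subset (Finset.filter_subset _ _)).2 ⟨m, hm, by simp⟩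
  · rw [Finset.card_range, Finset.card_image_of_injOn (injOn_card_filter_lt S)]

/-- The number of messages whose position lies in a sub-interval. -/
lemma card_ones {p α β : ℝ} {L : Labelling} (hL : oneInterval p L = Ico α β) (hβ : β ≤ 1)
    (S : Finset (Fin M)) :
    (ones p L S).card = ⌈β * S.card⌉₊ - ⌈α * S.card⌉₊ := by
  rcases Nat.eq_zero_or_pos S.card with h0 | hpos
  · have := Finset.card_le_card (ones_subset p L S)
    rw [h0] at this ⊢
    simp [Nat.le_zero.1 this]
  have hs : (0 : ℝ) < S.card := by exact_mod_cast hpos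
  rw [← Nat.card_Ico, ← Finset.card_image_of_injOn
    ((injOn_card_filter_lt S).mono (Finset.coe_subset.2 (ones_subset p L S)))]
  congr 1
  ext k
  have key : (k : ℝ) / S.card ∈ Ico α β ↔ ⌈α * S.card⌉₊ ≤ k ∧ k < ⌈β * S.card⌉₊ := by
    rw [mem_Ico, le_div_iff₀ hs, div_lt_iff₀ hs, Nat.ceil_le, Nat.lt_ceil]
  rw [Finset.mem_Ico, ← key, Finset.mem_image]
  constructor
  · rintro ⟨m, hm, rfl⟩
    simp only [ones, hL, Finset.mem_filter] at hm
    exact hm.2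
  · intro hk
    have hkS : k ∈ Finset.range S.card := by
      have h2 : (k : ℝ) < S.card := by
        have := (div_lt_iff₀ hs).1 hk.2
        nlinarith
      exact Finset.mem_range.2 (by exact_mod_cast h2)
    rw [← image_card_filter_lt, Finset.mem_image] at hkS
    obtain ⟨m, hm, rfl⟩ := hkS
    refine ⟨m, ?_, rfl⟩
    simp only [ones, hL, Finset.mem_filter]
    exact ⟨hm, hk⟩

lemma abs_ceil_sub_ceil_sub_le {x y : ℝ} (hx : 0 ≤ x) (hxy : x ≤ y) :
    |((⌈y⌉₊ - ⌈x⌉₊ : ℕ) : ℝ) - (y - x)| ≤ 1 := by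
  rw [Nat.cast_sub (Nat.ceil_mono hxy), abs_le]
  have h1 := Nat.le_ceil x
  have h2 := Nat.le_ceil y
  have h3 := Nat.ceil_lt_add_one hx
  have h4 := Nat.ceil_lt_add_one (hx.trans hxy)
  constructor <;> linarith

lemma abs_card_ones_first_sub_le {p : ℝ} (hp : p ∈ Icc (0 : ℝ) (1 / 2)) (S : Finset (Fin M)) :
    |((ones p .first S).card : ℝ) - p * S.card| ≤ 1 := by
  have hS : (0 : ℝ) ≤ S.card := by positivity
  have h : (ones p .first S).card = ⌈1 * (S.card : ℝ)⌉₊ - ⌈(1 - p) * S.card⌉₊ :=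
    card_ones rfl le_rfl S
  have h2 := abs_ceil_sub_ceil_sub_le (x := (1 - p) * S.card) (y := 1 * S.card)
    (mul_nonneg (by linarith [hp.2]) hS) (mul_le_mul_of_nonneg_right (by linarith [hp.1]) hS)
  rw [h]
  convert h2 using 2
  ring

/-- With q = p/(1-p) the left end is 1 - 2p, so this interval too has length p; p ≤ 1/2 keeps it
inside the unit interval. -/
lemma abs_card_ones_second_sub_le {p : ℝ} (hp : p ∈ Icc (0 : ℝ) (1 / 2)) (S : Finset (Fin M)) :
    |((ones p .second S).card : ℝ) - p * S.card| ≤ 1 := by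
  have hS : (0 : ℝ) ≤ S.card := by positivity
  have hq : (1 - p) * (1 - p / (1 - p)) = 1 - 2 * p := by
    have : 1 - p ≠ 0 := by linarith [hp.2]
    field_simp
    ring
  have h : (ones p .second S).card = ⌈(1 - p) * (S.card : ℝ)⌉₊ - ⌈(1 - 2 * p) * S.card⌉₊ :=
    card_ones (by rw [oneInterval, hq]) (by linarith [hp.1]) S
  have h2 := abs_ceil_sub_ceil_sub_le (x := (1 - 2 * p) * S.card) (y := (1 - p) * S.card)
    (mul_nonneg (by linarith [hp.2]) hS) (mul_le_mul_of_nonneg_right (by linarith [hp.1]) hS)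
  rw [h]
  convert h2 using 2
  ring

lemma card_ones_add_card_zeros (p : ℝ) (L : Labelling) (S : Finset (Fin M)) :
    (ones p L S).card + (zeros p L S).card = S.card := by
  rw [zeros, add_comm, Finset.card_sdiff_add_card_eq_card (ones_subset p L S)]

lemma card_ones_half (p : ℝ) (S : Finset (Fin M)) :
    (ones p .half S).card = S.card - (S.card + 1) / 2 := by
  have h : (ones p .half S).card = ⌈1 * (S.card : ℝ)⌉₊ - ⌈(1 / 2) * (S.card : ℝ)⌉₊ :=
    card_ones rfl le_rfl S
  rw [h, one_mul, Nat.ceil_natCast]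
  congr 1
  refine eq_of_forall_ge_iff fun k => ?_
  rw [Nat.ceil_le]
  have : (1 / 2 : ℝ) * S.card ≤ k ↔ S.card ≤ 2 * k := by
    rw [← Nat.cast_le (α := ℝ)]
    push_cast
    constructor <;> intro h <;> linarith
  rw [this]
  omega

/-- `Nat.clog 2` counts the digits still needed: even the larger half has only (s+1)/2 elements, so
each received digit lowers it. -/
lemma clog_card_ones_half_lt (p : ℝ) {S : Finset (Fin M)} (h : 2 ≤ S.card) :
    Nat.clog 2 (ones p .half S).card + 1 ≤ Nat.clog 2 S.card := by
  rw [Nat.clog_of_two_le one_lt_two h]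
  gcongr
  rw [card_ones_half]
  omega

lemma clog_card_zeros_half_lt (p : ℝ) {S : Finset (Fin M)} (h : 2 ≤ S.card) :
    Nat.clog 2 (zeros p .half S).card + 1 ≤ Nat.clog 2 S.card := by
  rw [Nat.clog_of_two_le one_lt_two h]
  gcongr
  have := card_ones_add_card_zeros p .half S
  rw [card_ones_half] at this
  omega

end

/-! ### The running time of the scheme -/

section

variable {M : ℕ}

/-- The number of possible messages times the expectation of `Φ` after the next channel use, for
a message that is uniformly distributed on the possible ones. -/
noncomputable def nextValue (ε p : ℝ) (l : ℕ) (Φ : State M → ℝ) (s : State M) : ℝ :=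
  ε * (s.possible.card * Φ (step p l s none)) +
    (1 - ε) * ((sentOnes p s).card * Φ (step p l s (some true)) +
      (s.possible \ sentOnes p s).card * Φ (step p l s (some false)))

/-- The expectation of `Φ` at time `n`, times the number of messages. -/
noncomputable def totalValue (ε p : ℝ) (l : ℕ) (Φ : State M → ℝ) (n : ℕ) : ℝ :=
  ∑ y : Fin n → Output, weight ε y *
    ((compat (schemeStream p l M) y).card * Φ (run p l M y))

/-- Reduces the evolution of an expectation to a single state. Only well-formed states occur, and
outputs with no compatible message contribute zero to both sides. -/
lemma totalValue_succ_le {ε p : ℝ} (hε : ε ∈ Icc (0 : ℝ) 1) {l : ℕ} {Φ Ψ : State M → ℝ}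
    (h : ∀ s, WellFormed l s → nextValue ε p l Φ s ≤ s.possible.card * Ψ s) (n : ℕ) :
    totalValue ε p l Φ (n + 1) ≤ totalValue ε p l Ψ n := by
  refine sum_weight_succ_le hε _ _ fun y => ?_
  rw [run_snoc, run_snoc, run_snoc, compat_snoc_none, compat_snoc_true, compat_snoc_false]
  rcases compat_schemeStream (M := M) p l y with h0 | h0
  · simp [h0]
  · have hB : ((run p l M y).possible.filter fun m => schemeStream p l M n m y = true) =
        sentOnes p (run p l M y) := filter_emit p _
    rw [h0, hB]
    exact h _ (wellFormed_run p l y)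

lemma totalValue_neg (ε p : ℝ) (l : ℕ) (Φ : State M → ℝ) (n : ℕ) :
    totalValue ε p l (fun s => -Φ s) n = -totalValue ε p l Φ n := by
  simp [totalValue]

lemma le_totalValue_succ {ε p : ℝ} (hε : ε ∈ Icc (0 : ℝ) 1) {l : ℕ} {Φ Ψ : State M → ℝ}
    (h : ∀ s, WellFormed l s → s.possible.card * Ψ s ≤ nextValue ε p l Φ s) (n : ℕ) :
    totalValue ε p l Ψ n ≤ totalValue ε p l Φ (n + 1) := by
  rw [← neg_le_neg_iff, ← totalValue_neg, ← totalValue_neg]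
  refine totalValue_succ_le hε (fun s hs => ?_) n
  have := h s hs
  rw [← neg_le_neg_iff] at this
  convert this using 1
  · simp only [nextValue]; ring
  · ring

lemma totalValue_mono {ε p : ℝ} (hε : ε ∈ Icc (0 : ℝ) 1) {l : ℕ} {Φ Ψ : State M → ℝ}
    (h : ∀ s, WellFormed l s → Φ s ≤ Ψ s) (n : ℕ) :
    totalValue ε p l Φ n ≤ totalValue ε p l Ψ n :=
  Finset.sum_le_sum fun y _ => mul_le_mul_of_nonneg_left
    (mul_le_mul_of_nonneg_left (h _ (wellFormed_run p l y)) (Nat.cast_nonneg _))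
    (weight_nonneg hε y)

lemma totalValue_zero (ε p : ℝ) (l : ℕ) (Φ : State M → ℝ) :
    totalValue ε p l Φ 0 = M * Φ (begin l Finset.univ) := by
  simp [totalValue, weight, compat_zero, run_zero]

/-- The indicator of the states in which the scheme is not over. -/
def running (s : State M) : ℝ := if s.phase = .done then 0 else 1

lemma totalValue_running {ε p : ℝ} {l : ℕ} (hM : 0 < M) (n : ℕ) :
    totalValue ε p l (running (M := M)) n = M * runningProb ε p l M n :=
  (mul_runningProb ε p l M n hM).symm

/-! ### An exponential bound for the running time -/

/-- The potential of a new round with `k` possible messages. -/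
noncomputable def beginValue (θ D : ℝ) (l k : ℕ) : ℝ :=
  if k ≤ 2 ^ l then D ^ Nat.clog 2 k else D ^ l * (k : ℝ) ^ θ

/-- A potential that decreases at least by the factor `μ` per channel use, on the average. -/
noncomputable def expPotential (θ D μ : ℝ) (l : ℕ) (s : State M) : ℝ :=
  match s.phase with
  | .send1 => D ^ l * (s.possible.card : ℝ) ^ θ
  | .send2 => D ^ l * (s.possible.card : ℝ) ^ θ
  | .pair => D ^ Nat.clog 2 s.possible.card
  | .zero => μ⁻¹ * beginValue θ D l s.possible.card
  | .done => 0

variable {θ D μ : ℝ}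

lemma one_le_beginValue (hθ : 0 ≤ θ) (hD : 1 ≤ D) (l k : ℕ) : 1 ≤ beginValue θ D l k := by
  unfold beginValue
  split_ifs with h
  · exact one_le_pow₀ hD
  · have : (1 : ℝ) ≤ k := by
      have : 1 ≤ 2 ^ l := Nat.one_le_two_pow
      exact_mod_cast (by omega : 1 ≤ k)
    exact one_le_mul_of_one_le_of_one_le (one_le_pow₀ hD) (Real.one_le_rpow this hθ)

/-- The factor `k` covers the empty set, for which `beginValue` is 1 but the power on the right
vanishes if θ > 0. -/
lemma mul_beginValue_le (hθ : 0 ≤ θ) (hD : 1 ≤ D) (l k : ℕ) :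
    k * beginValue θ D l k ≤ D ^ l * (k * (k : ℝ) ^ θ) := by
  rcases Nat.eq_zero_or_pos k with rfl | hk
  · simp
  · rw [mul_left_comm]
    refine mul_le_mul_of_nonneg_left ?_ (Nat.cast_nonneg k)
    unfold beginValue
    split_ifs with h
    · have h1 : D ^ Nat.clog 2 k ≤ D ^ l :=
        pow_le_pow_right₀ hD ((Nat.clog_le_iff_le_pow one_lt_two).2 h)
      have h2 : 1 ≤ (k : ℝ) ^ θ := Real.one_le_rpow (by exact_mod_cast hk) hθ
      exact h1.trans (le_mul_of_one_le_right (by positivity) h2)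
    · exact le_rfl

lemma expPotential_begin_le (hθ : 0 ≤ θ) (hD : 1 ≤ D) (l : ℕ) (S : Finset (Fin M)) :
    expPotential θ D μ l (begin l S) ≤ beginValue θ D l S.card := by
  have := one_le_beginValue hθ hD l S.card
  unfold begin
  split_ifs with h1 h2
  · simp only [expPotential]; linarith
  · simp [expPotential, beginValue, h2]
  · simp [expPotential, beginValue, h2]

lemma running_le_expPotential (hθ : 0 ≤ θ) (hD : 1 ≤ D) (hμ : 0 < μ) (hμ1 : μ ≤ 1) (l : ℕ)
    (s : State M) (hs : WellFormed l s) : running s ≤ expPotential θ D μ l s := by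
  have key : ∀ k : ℕ, 1 < k → 1 ≤ D ^ l * (k : ℝ) ^ θ := fun k hk =>
    one_le_mul_of_one_le_of_one_le (one_le_pow₀ hD)
      (Real.one_le_rpow (by exact_mod_cast hk.le) hθ)
  rcases s with ⟨S, _ | _ | _ | _ | _⟩ <;> simp only [running, expPotential, reduceCtorEq, if_false, if_true]
  · exact key _ hs.1
  · exact key _ hs.1
  · exact one_le_pow₀ hD
  · exact one_le_mul_of_one_le_of_one_le ((one_le_inv₀ hμ).2 hμ1) (one_le_beginValue hθ hD _ _)
  · exact le_rfl

/-- Everything is homogeneous of degree 1 + θ in the set size; dividing by it leaves a condition on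
the fraction of ones. The factor `μ⁻¹` pays for the zero that follows a received one. -/
lemma send_step {ε : ℝ} (hε : ε ∈ Icc (0 : ℝ) 1) (hθ : 0 ≤ θ) (hD : 1 ≤ D) (hμ : 0 < μ) {l : ℕ}
    {S B C : Finset (Fin M)} (hBC : B.card + C.card = S.card) (hS : 0 < S.card)
    (h : ε + (1 - ε) * (μ⁻¹ * ((B.card / S.card : ℝ) * (B.card / S.card : ℝ) ^ θ) +
      (1 - B.card / S.card : ℝ) * (1 - B.card / S.card : ℝ) ^ θ) ≤ μ) :
    ε * (S.card * (D ^ l * (S.card : ℝ) ^ θ)) +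
      (1 - ε) * (B.card * (μ⁻¹ * beginValue θ D l B.card) +
        C.card * expPotential θ D μ l (begin l C)) ≤
      S.card * (μ * (D ^ l * (S.card : ℝ) ^ θ)) := by
  have hε' : 0 ≤ 1 - ε := by linarith [hε.2]
  have hk : (0 : ℝ) < S.card := by exact_mod_cast hS
  have hC : (1 - B.card / S.card : ℝ) = C.card / S.card := by
    rw [← hBC]; push_cast
    rw [← hBC] at hk; push_cast at hk
    field_simp
    ring
  rw [hC, Real.div_rpow (by positivity) hk.le, Real.div_rpow (by positivity) hk.le] at h
  have h1 := mul_beginValue_le hθ hD l B.card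
  have h2 := (mul_le_mul_of_nonneg_left (expPotential_begin_le (μ := μ) hθ hD l C)
    (Nat.cast_nonneg C.card)).trans (mul_beginValue_le hθ hD l C.card)
  have hkθ : (0 : ℝ) < (S.card : ℝ) ^ θ := Real.rpow_pos_of_pos hk θ
  have hpos : 0 ≤ (S.card : ℝ) * (D ^ l * (S.card : ℝ) ^ θ) := by positivity
  calc _ = ε * (S.card * (D ^ l * (S.card : ℝ) ^ θ)) +
      (1 - ε) * (μ⁻¹ * (B.card * beginValue θ D l B.card) +
        C.card * expPotential θ D μ l (begin l C)) := by ring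
    _ ≤ ε * (S.card * (D ^ l * (S.card : ℝ) ^ θ)) +
      (1 - ε) * (μ⁻¹ * (D ^ l * (B.card * (B.card : ℝ) ^ θ)) +
        D ^ l * (C.card * (C.card : ℝ) ^ θ)) := by gcongr
    _ = (ε + (1 - ε) * (μ⁻¹ * ((B.card / S.card : ℝ) * ((B.card : ℝ) ^ θ / (S.card : ℝ) ^ θ)) +
          (C.card / S.card : ℝ) * ((C.card : ℝ) ^ θ / (S.card : ℝ) ^ θ))) *
        (S.card * (D ^ l * (S.card : ℝ) ^ θ)) := by
      field_simp
    _ ≤ μ * (S.card * (D ^ l * (S.card : ℝ) ^ θ)) := mul_le_mul_of_nonneg_right h hpos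
    _ = _ := by ring

/-- A pair takes two channel uses, hence `μ ^ 2`; a received digit gains the factor `D⁻¹`. -/
lemma pair_step {ε : ℝ} (hε : ε ∈ Icc (0 : ℝ) 1) (hD : 1 ≤ D) (hμ : 0 < μ)
    (h : ε + (1 - ε) * D⁻¹ ≤ μ ^ 2) {l k b c : ℕ} (hbc : b + c = k) (hk : k ≤ 2 ^ l)
    (hb : Nat.clog 2 b + 1 ≤ Nat.clog 2 k) (hc : Nat.clog 2 c + 1 ≤ Nat.clog 2 k) :
    ε * (k * (μ⁻¹ * beginValue θ D l k)) +
      (1 - ε) * (b * (μ⁻¹ * beginValue θ D l b) + c * (μ⁻¹ * beginValue θ D l c)) ≤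
      k * (μ * D ^ Nat.clog 2 k) := by
  have hε' : 0 ≤ 1 - ε := by linarith [hε.2]
  have hD0 : 0 < D := by linarith
  have half : ∀ j : ℕ, Nat.clog 2 j + 1 ≤ Nat.clog 2 k → j ≤ k →
      beginValue θ D l j ≤ D⁻¹ * D ^ Nat.clog 2 k := by
    intro j hj hjk
    rw [beginValue, if_pos (hjk.trans hk), le_inv_mul_iff₀ hD0, ← pow_succ']
    exact pow_le_pow_right₀ hD hj
  have h1 := half b hb (by omega)
  have h2 := half c hc (by omega)
  have hk' : (k : ℝ) = b + c := by exact_mod_cast hbc.symm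
  calc _ ≤ ε * (k * (μ⁻¹ * D ^ Nat.clog 2 k)) +
      (1 - ε) * (b * (μ⁻¹ * (D⁻¹ * D ^ Nat.clog 2 k)) +
        c * (μ⁻¹ * (D⁻¹ * D ^ Nat.clog 2 k))) := by
        rw [show beginValue θ D l k = D ^ Nat.clog 2 k from if_pos hk]
        gcongr
    _ = (ε + (1 - ε) * D⁻¹) * (μ⁻¹ * (k * D ^ Nat.clog 2 k)) := by rw [hk']; ring
    _ ≤ μ ^ 2 * (μ⁻¹ * (k * D ^ Nat.clog 2 k)) := by gcongr
    _ = _ := by field_simp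

/-- While labels are sent, |S| > 2^l, so rounding moves the fraction of ones from p by at most
2^{-l}. -/
lemma nextValue_expPotential_le {ε p : ℝ} (hε : ε ∈ Icc (0 : ℝ) 1)
    (hp : p ∈ Icc (0 : ℝ) (1 / 2)) (hθ : 0 ≤ θ) (hD : 1 ≤ D) (hμ : 0 < μ) {l : ℕ}
    (hpair : ε + (1 - ε) * D⁻¹ ≤ μ ^ 2)
    (hsend : ∀ a : ℝ, |a - p| ≤ 1 / 2 ^ l →
      ε + (1 - ε) * (μ⁻¹ * (a * a ^ θ) + (1 - a) * (1 - a) ^ θ) ≤ μ)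
    (s : State M) (hs : WellFormed l s) :
    nextValue ε p l (expPotential θ D μ l) s ≤
      s.possible.card * (μ * expPotential θ D μ l s) := by
  have hfrac : ∀ (S B : Finset (Fin M)), 2 ^ l < S.card → |(B.card : ℝ) - p * S.card| ≤ 1 →
      |(B.card / S.card : ℝ) - p| ≤ 1 / 2 ^ l := by
    intro S B hS hB
    have hl : (2 : ℝ) ^ l ≤ S.card := by exact_mod_cast hS.le
    have hl0 : (0 : ℝ) < 2 ^ l := by positivity
    have hS0 : (0 : ℝ) < S.card := hl0.trans_le hl
    rw [show (B.card / S.card : ℝ) - p = (B.card - p * S.card) / S.card by field_simp,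
      abs_div, abs_of_pos hS0]
    exact div_le_div₀ zero_le_one hB hl0 hl
  rcases s with ⟨S, _ | _ | _ | _ | _⟩ <;>
    simp only [nextValue, step, sentOnes, expPotential]
  · exact send_step hε hθ hD hμ (card_ones_add_card_zeros _ _ _) (by have := hs.1; dsimp at this; omega)
      (hsend _ (hfrac _ _ hs.2 (abs_card_ones_first_sub_le hp S)))
  · exact send_step hε hθ hD hμ (card_ones_add_card_zeros _ _ _) (by have := hs.1; dsimp at this; omega)
      (hsend _ (hfrac _ _ hs.2 (abs_card_ones_second_sub_le hp S)))
  · exact pair_step hε hD hμ hpair (card_ones_add_card_zeros p .half S) hs.2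
      (clog_card_ones_half_lt p hs.1) (clog_card_zeros_half_lt p hs.1)
  · have := mul_le_mul_of_nonneg_left (expPotential_begin_le (μ := μ) hθ hD l S)
      (Nat.cast_nonneg S.card)
    simp only [Finset.card_empty, Finset.sdiff_empty, mul_inv_cancel_left₀ hμ.ne']
    simp only [expPotential] at this
    push_cast
    linarith
  · simp

/-- The exponential bound for the running time of the scheme. -/
theorem runningProb_le {ε p : ℝ} (hε : ε ∈ Icc (0 : ℝ) 1)
    (hp : p ∈ Icc (0 : ℝ) (1 / 2)) (hθ : 0 ≤ θ) (hD : 1 ≤ D) (hμ : 0 < μ) (hμ1 : μ ≤ 1) {l : ℕ}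
    (hpair : ε + (1 - ε) * D⁻¹ ≤ μ ^ 2)
    (hsend : ∀ a : ℝ, |a - p| ≤ 1 / 2 ^ l →
      ε + (1 - ε) * (μ⁻¹ * (a * a ^ θ) + (1 - a) * (1 - a) ^ θ) ≤ μ)
    (hM : 0 < M) (n : ℕ) : runningProb ε p l M n ≤ μ ^ n * (D ^ l * (M : ℝ) ^ θ) := by
  have hM' : (0 : ℝ) < M := by exact_mod_cast hM
  have hmul : ∀ n, totalValue ε p l (fun s : State M => μ * expPotential θ D μ l s) n =
      μ * totalValue ε p l (expPotential (M := M) θ D μ l) n := by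
    intro n
    rw [totalValue, totalValue, Finset.mul_sum]
    exact Finset.sum_congr rfl fun y _ => by ring
  have h : totalValue ε p l (expPotential (M := M) θ D μ l) n ≤
      μ ^ n * (M * (D ^ l * (M : ℝ) ^ θ)) := by
    induction n with
    | zero =>
      have h1 := mul_le_mul_of_nonneg_left (expPotential_begin_le (μ := μ) hθ hD l
        (Finset.univ : Finset (Fin M))) hM'.le
      have h2 := mul_beginValue_le hθ hD l M
      rw [Finset.card_univ, Fintype.card_fin] at h1
      rw [totalValue_zero, pow_zero, one_mul]
      linarith
    | succ n ih =>
      calc _ ≤ _ := totalValue_succ_le hε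
            (nextValue_expPotential_le (M := M) hε hp hθ hD hμ hpair hsend) n
        _ = _ := hmul n
        _ ≤ μ * (μ ^ n * (M * (D ^ l * (M : ℝ) ^ θ))) := by gcongr
        _ = _ := by ring
  have h3 := (totalValue_mono hε (running_le_expPotential (M := M) hθ hD hμ hμ1 l) n).trans h
  rw [totalValue_running hM] at h3
  refine le_of_mul_le_mul_left ?_ hM'
  linarith

/-! ### A lower bound for the running time -/

/-- The remaining information, corrected for the zero that follows a one. -/
noncomputable def logPotential (r : ℝ) (s : State M) : ℝ :=
  Real.log s.possible.card + if s.phase = .zero then r else 0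

lemma logPotential_begin (r : ℝ) (l : ℕ) (S : Finset (Fin M)) :
    logPotential r (begin l S) = Real.log S.card := by
  have : (begin l S).phase ≠ .zero := by
    unfold begin; dsimp only; split_ifs <;> simp
  rw [logPotential, if_neg this, add_zero]
  rfl

/-- Entropy grouping gives the mean loss of log|S|, and the credit `r` after a received one pays for
the zero; `h` bounds the net loss of any labelling, whatever its fraction of ones. -/
lemma le_nextValue_logPotential {ε p r : ℝ} (hε : ε ∈ Icc (0 : ℝ) 1) (hr : 0 ≤ r)
    (h : ∀ a ∈ Icc (0 : ℝ) 1, (1 - ε) * (Real.binEntropy a - a * r) ≤ r) {l : ℕ} (s : State M) :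
    s.possible.card * (logPotential r s - r * running s) ≤
      nextValue ε p l (logPotential r) s := by
  have hε' : 0 ≤ 1 - ε := by linarith [hε.2]
  have key : ∀ (L : Labelling) (S : Finset (Fin M)),
      S.card * (Real.log S.card - r) ≤ ε * (S.card * Real.log S.card) +
        (1 - ε) * ((ones p L S).card * (Real.log (ones p L S).card + r) +
          (zeros p L S).card * Real.log (zeros p L S).card) := by
    intro L S
    have hadd := card_ones_add_card_zeros p L S
    have h1 := card_mul_log_sub hadd
    rcases Nat.eq_zero_or_pos S.card with h0 | hS
    · rw [h0] at hadd ⊢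
      obtain ⟨hb, hc⟩ : (ones p L S).card = 0 ∧ (zeros p L S).card = 0 := by omega
      simp [hb, hc]
    · have hS' : (0 : ℝ) < S.card := by exact_mod_cast hS
      have h2 := mul_le_mul_of_nonneg_left (h ((ones p L S).card / S.card)
        ⟨by positivity, div_le_one_of_le₀
          (by exact_mod_cast Finset.card_le_card (ones_subset p L S)) hS'.le⟩) hS'.le
      have h3 : (S.card : ℝ) * ((1 - ε) * (Real.binEntropy ((ones p L S).card / S.card) -
          (ones p L S).card / S.card * r)) = (1 - ε) * (S.card *
            Real.binEntropy ((ones p L S).card / S.card) - (ones p L S).card * r) := by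
        field_simp
      have h4 : (1 - ε) * ((ones p L S).card * Real.log (ones p L S).card +
          (zeros p L S).card * Real.log (zeros p L S).card) = (1 - ε) * (S.card *
            Real.log S.card - S.card * Real.binEntropy ((ones p L S).card / S.card)) := by rw [h1]
      linarith
  rcases s with ⟨S, _ | _ | _ | _ | _⟩ <;>
    simp only [nextValue, step, sentOnes, logPotential_begin] <;>
    simp only [logPotential, running, reduceCtorEq, if_false, if_true, mul_one, add_zero]
  · exact key _ _
  · exact key _ _
  -- A pair ends in a zero whatever is received, so there is credit also after an erasure or a
  -- received zero; these terms are nonnegative and only help.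
  · have h1 := key .half S
    have h2 : 0 ≤ ε * (S.card * r) := by have := hε.1; positivity
    have h3 : 0 ≤ (1 - ε) * ((zeros p .half S).card * r) := by positivity
    rw [← zeros]
    linarith
  · simp
    linarith
  · simp
    linarith

lemma logPotential_le_running {r : ℝ} (hr : 0 ≤ r) {l : ℕ} (s : State M) (hs : WellFormed l s) :
    logPotential r s ≤ (Real.log M + r) * running s := by
  have hle : s.possible.card ≤ M := (Finset.card_le_univ _).trans_eq (Fintype.card_fin M)
  have h1 : Real.log s.possible.card ≤ Real.log M := by
    rcases Nat.eq_zero_or_pos s.possible.card with h0 | h0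
    · rw [h0]; simpa using Real.log_natCast_nonneg M
    · exact Real.log_le_log (by exact_mod_cast h0) (by exact_mod_cast hle)
  unfold logPotential running
  by_cases hd : s.phase = .done
  · have hc : s.possible.card ≤ 1 := by rwa [WellFormed, hd] at hs
    have : Real.log s.possible.card = 0 := by interval_cases s.possible.card <;> simp
    simp [hd, this]
  · rw [if_neg hd]
    split_ifs <;> linarith

/-- The lower bound for the running time, cut off at `n`. -/
theorem log_le_runningProb {ε p r : ℝ} (hε : ε ∈ Icc (0 : ℝ) 1) (hr : 0 ≤ r)
    (h : ∀ a ∈ Icc (0 : ℝ) 1, (1 - ε) * (Real.binEntropy a - a * r) ≤ r) (l : ℕ) (hM : 0 < M)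
    (n : ℕ) : Real.log M ≤ (Real.log M + r) * runningProb ε p l M n +
      r * ∑ i ∈ Finset.range n, runningProb ε p l M i := by
  have hM' : (0 : ℝ) < M := by exact_mod_cast hM
  have hlin : ∀ n, totalValue ε p l (fun s : State M => logPotential r s - r * running s) n =
      totalValue ε p l (logPotential (M := M) r) n - r * (M * runningProb ε p l M n) := by
    intro n
    rw [← totalValue_running hM, totalValue, totalValue, totalValue, Finset.mul_sum,
      ← Finset.sum_sub_distrib]
    exact Finset.sum_congr rfl fun y _ => by ring
  have h1 : M * Real.log M ≤ totalValue ε p l (logPotential (M := M) r) n +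
      r * (M * ∑ i ∈ Finset.range n, runningProb ε p l M i) := by
    induction n with
    | zero => simp [totalValue_zero, logPotential_begin]
    | succ n ih =>
      have := le_totalValue_succ hε
        (fun s _ => le_nextValue_logPotential (M := M) (p := p) (l := l) hε hr h s) n
      rw [hlin] at this
      rw [Finset.sum_range_succ]
      linarith
  have hmul : totalValue ε p l (fun s : State M => (Real.log M + r) * running s) n =
      (Real.log M + r) * (M * runningProb ε p l M n) := by
    rw [← totalValue_running hM, totalValue, totalValue, Finset.mul_sum]
    exact Finset.sum_congr rfl fun y _ => by ring
  have h2 := totalValue_mono (M := M) (p := p) hε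
    (fun s hs => logPotential_le_running (M := M) (l := l) hr s hs) n
  rw [hmul] at h2
  refine le_of_mul_le_mul_left ?_ hM'
  linarith

end

/-! ### Rates of the scheme -/

section

/-- The reward of the optimal labelling exceeds any `r` below the capacity, to first order in the
exponent. -/
lemma eventually_exponent_lt {ε p r : ℝ} (hp0 : 0 < p) (hp1 : p < 1)
    (h : r < (1 - ε) * (Real.binEntropy p - p * r)) :
    ∀ᶠ θ : ℝ in 𝓝[>] 0, ε + (1 - ε) * ((Real.exp (-θ * r))⁻¹ * (p * p ^ θ) +
      (1 - p) * (1 - p) ^ θ) < Real.exp (-θ * r) := by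
  have hq : 0 < 1 - p := by linarith
  -- The two sides agree at θ = 0, so the sign of the derivative of their difference decides for
  -- small θ > 0; it is negative exactly by `h`.
  have hder : HasDerivAt (fun θ : ℝ => ε + (1 - ε) * (Real.exp (θ * r) * (p * p ^ θ) +
      (1 - p) * (1 - p) ^ θ) - Real.exp (-θ * r))
      ((1 - ε) * ((r * p + p * Real.log p) + (1 - p) * Real.log (1 - p)) + r) 0 := by
    have h1 : HasDerivAt (fun θ : ℝ => Real.exp (θ * r)) r 0 := by
      simpa using ((hasDerivAt_id (0 : ℝ)).mul_const r).exp
    have h2 : HasDerivAt (fun θ : ℝ => Real.exp (-θ * r)) (-r) 0 := by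
      simpa using ((hasDerivAt_id (0 : ℝ)).neg.mul_const r).exp
    have hpow : ∀ x : ℝ, 0 < x → HasDerivAt (fun θ : ℝ => x ^ θ) (Real.log x) 0 := by
      intro x hx
      simpa using (hasDerivAt_id (0 : ℝ)).const_rpow hx
    have h3 := (((h1.mul ((hpow p hp0).const_mul p)).add
      ((hpow (1 - p) hq).const_mul (1 - p))).const_mul (1 - ε)).const_add ε |>.sub h2
    refine h3.congr_deriv ?_
    simp
  have hneg : (1 - ε) * ((r * p + p * Real.log p) + (1 - p) * Real.log (1 - p)) + r < 0 := by
    rw [Real.binEntropy, Real.log_inv, Real.log_inv] at h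
    linarith
  have h4 := (hasDerivAt_iff_tendsto_slope.1 hder).eventually_lt_const hneg
  have h5 := h4.filter_mono (nhdsWithin_mono 0 (fun x hx => (mem_Ioi.1 hx).ne' : Ioi (0 : ℝ) ⊆ {0}ᶜ))
  filter_upwards [h5, self_mem_nhdsWithin] with θ hθ hθ0
  have hθ0 : 0 < θ := hθ0
  rw [slope_def_field, div_lt_iff₀ (by linarith)] at hθ
  rw [neg_mul, Real.exp_neg, inv_inv]
  simp [Real.exp_neg] at hθ
  linarith

/-- The scheme works at any rate `r` (in nats) below the capacity: the probability that it is not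
over decreases exponentially. -/
theorem exists_runningProb_le {ε p r : ℝ} (hε : ε ∈ Icc (0 : ℝ) 1) (hε1 : ε < 1)
    (hp : p ∈ Icc (0 : ℝ) (1 / 2)) (hp0 : 0 < p) (hr : 0 < r)
    (h : r < (1 - ε) * (Real.binEntropy p - p * r)) :
    ∃ θ > 0, ∃ D : ℝ, 1 ≤ D ∧ ∃ l₀ : ℕ, ∀ l ≥ l₀, ∀ M > 0, ∀ n,
      runningProb ε p l M n ≤ Real.exp (-θ * r) ^ n * (D ^ l * (M : ℝ) ^ θ) := by
  have hq : 0 < 1 - p := by linarith [hp.2]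
  have hsq : ∀ᶠ θ : ℝ in 𝓝[>] 0, ε < Real.exp (-θ * r) ^ 2 := by
    have : Tendsto (fun θ : ℝ => Real.exp (-θ * r) ^ 2) (𝓝 0) (𝓝 (Real.exp (-0 * r) ^ 2)) :=
      Continuous.tendsto (by fun_prop) 0
    refine (this.mono_left nhdsWithin_le_nhds).eventually_const_lt ?_
    simpa using hε1
  -- θ is fixed first. Then `D` is the least value ≥ 1 allowed by `hpair`, and `l₀` comes from
  -- continuity at p of the condition on the fraction.
  obtain ⟨θ, h1, h2, hθ⟩ := ((eventually_exponent_lt hp0 (by linarith) h).and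
    (hsq.and self_mem_nhdsWithin)).exists
  have hθ : 0 < θ := hθ
  set μ := Real.exp (-θ * r) with hμdef
  have hμ : 0 < μ := Real.exp_pos _
  have hμ1 : μ ≤ 1 := Real.exp_le_one_iff.2 (by nlinarith)
  set D := max 1 ((1 - ε) / (μ ^ 2 - ε)) with hDdef
  have hD : 1 ≤ D := le_max_left _ _
  have hpair : ε + (1 - ε) * D⁻¹ ≤ μ ^ 2 := by
    have h3 : (1 - ε) / (μ ^ 2 - ε) ≤ D := le_max_right _ _
    rw [div_le_iff₀ (by linarith)] at h3
    have h4 : (1 - ε) * D⁻¹ ≤ μ ^ 2 - ε := by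
      rw [← div_eq_mul_inv, div_le_iff₀ (by linarith)]
      linarith
    linarith
  have hcont : ContinuousAt (fun a : ℝ => ε + (1 - ε) * (μ⁻¹ * (a * a ^ θ) +
      (1 - a) * (1 - a) ^ θ)) p := by
    refine Continuous.continuousAt ?_
    have h3 : Continuous fun a : ℝ => a ^ θ := Real.continuous_rpow_const hθ.le
    have h4 : Continuous fun a : ℝ => (1 - a) ^ θ := h3.comp (continuous_const.sub continuous_id)
    fun_prop
  obtain ⟨η, hη, hball⟩ := Metric.eventually_nhds_iff.1 (hcont.eventually_lt_const h1)
  obtain ⟨l₀, hl₀⟩ := exists_pow_lt_of_lt_one hη (show (1 / 2 : ℝ) < 1 by norm_num)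
  refine ⟨θ, hθ, D, hD, l₀, fun l hl M hM n => ?_⟩
  refine runningProb_le hε hp hθ.le hD hμ hμ1 hpair (fun a ha => (hball ?_).le) hM n
  rw [Real.dist_eq]
  refine ha.trans_lt (lt_of_le_of_lt ?_ hl₀)
  rw [← one_div_pow]
  exact pow_le_pow_of_le_one (by norm_num) (by norm_num) hl

lemma runningProb_nonneg {ε : ℝ} (hε : ε ∈ Icc (0 : ℝ) 1) (p : ℝ) (l M n : ℕ) :
    0 ≤ runningProb ε p l M n := by
  refine div_nonneg (Finset.sum_nonneg fun m _ => Finset.sum_nonneg fun y _ => ?_)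
    (Nat.cast_nonneg M)
  rw [← truncate_schemeStream, law_truncate]
  split_ifs
  exacts [le_rfl, weight_nonneg hε y, le_rfl]

lemma runningProb_le_one {ε : ℝ} (hε : ε ∈ Icc (0 : ℝ) 1) (p : ℝ) (l : ℕ) {M : ℕ} (hM : 0 < M)
    (n : ℕ) : runningProb ε p l M n ≤ 1 := by
  have hM' : (0 : ℝ) < M := by exact_mod_cast hM
  refine le_of_mul_le_mul_left ?_ hM'
  rw [mul_runningProb ε p l M n hM, mul_one,
    ← sum_weight_card_compat (e := schemeStream p l M) ε n]
  refine Finset.sum_le_sum fun y _ => mul_le_mul_of_nonneg_left ?_ (weight_nonneg hε y)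
  refine mul_le_of_le_one_right (Nat.cast_nonneg _) ?_
  split_ifs <;> norm_num

lemma expectedUses_eq {ε : ℝ} (hε : ε ∈ Icc (0 : ℝ) 1) {p : ℝ} {l M : ℕ}
    (h : Summable (runningProb ε p l M)) :
    expectedUses ε p l M = ENNReal.ofReal (∑' n, runningProb ε p l M n) :=
  (ENNReal.ofReal_tsum_of_nonneg (runningProb_nonneg hε p l M) h).symm

lemma runningProb_zero_messages (ε p : ℝ) (l n : ℕ) : runningProb ε p l 0 n = 0 := by
  simp [runningProb]

/-- A sequence that is bounded by one and by a geometric sequence. -/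
lemma tsum_le_of_le_geometric {u : ℕ → ℝ} {μ A : ℝ} (hu0 : ∀ n, 0 ≤ u n) (hu1 : ∀ n, u n ≤ 1)
    (hμ : 0 ≤ μ) (hμ1 : μ < 1) (hu : ∀ n, u n ≤ μ ^ n * A) (N : ℕ) :
    Summable u ∧ ∑' n, u n ≤ N + μ ^ N * A / (1 - μ) := by
  have hsum : Summable u :=
    Summable.of_nonneg_of_le hu0 hu ((summable_geometric_of_lt_one hμ hμ1).mul_right A)
  refine ⟨hsum, ?_⟩
  rw [← hsum.sum_add_tsum_nat_add N]
  refine add_le_add ?_ ?_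
  · calc _ ≤ ∑ _i ∈ Finset.range N, (1 : ℝ) := Finset.sum_le_sum fun i _ => hu1 i
      _ = N := by simp
  · have h1 : HasSum (fun n => μ ^ n * (μ ^ N * A)) ((1 - μ)⁻¹ * (μ ^ N * A)) :=
      (hasSum_geometric_of_lt_one hμ hμ1).mul_right _
    calc _ ≤ ∑' n, μ ^ n * (μ ^ N * A) := by
            refine Summable.tsum_le_tsum (fun n => ?_) ((summable_nat_add_iff N).2 hsum) h1.summable
            exact (hu (n + N)).trans_eq (by rw [pow_add]; ring)
      _ = _ := by rw [h1.tsum_eq]; ring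

/-- The rate of the scheme, up to `r` in nats. -/
lemma expectedUses_le {ε p r θ D : ℝ} (hε : ε ∈ Icc (0 : ℝ) 1) (hr : 0 < r) (hθ : 0 < θ)
    (hD : 1 ≤ D) {l M : ℕ} (hM : 0 < M)
    (h : ∀ n, runningProb ε p l M n ≤ Real.exp (-θ * r) ^ n * (D ^ l * (M : ℝ) ^ θ)) :
    Summable (runningProb ε p l M) ∧ ∑' n, runningProb ε p l M n ≤
      Real.log M / r + 1 + D ^ l / (1 - Real.exp (-θ * r)) := by
  have hM' : (0 : ℝ) < M := by exact_mod_cast hM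
  have hlog : 0 ≤ Real.log M / r := div_nonneg (Real.log_natCast_nonneg M) hr.le
  have hμ1 : Real.exp (-θ * r) < 1 := Real.exp_lt_one_iff.2 (by nlinarith)
  -- The sum is split where e^{-θrn} M^θ falls to 1: earlier terms are at most one, later ones form
  -- a geometric series.
  obtain ⟨h1, h2⟩ := tsum_le_of_le_geometric (runningProb_nonneg hε p l M)
    (runningProb_le_one hε p l hM) (Real.exp_pos _).le hμ1 h ⌈Real.log M / r⌉₊
  refine ⟨h1, h2.trans (add_le_add (Nat.ceil_lt_add_one hlog).le ?_)⟩
  refine div_le_div_of_nonneg_right ?_ (by linarith)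
  have h3 : Real.exp (-θ * r) ^ ⌈Real.log M / r⌉₊ * (M : ℝ) ^ θ ≤ 1 := by
    rw [Real.rpow_def_of_pos hM', ← Real.exp_nat_mul, ← Real.exp_add, Real.exp_le_one_iff]
    have := (div_le_iff₀ hr).1 (Nat.le_ceil (Real.log M / r))
    nlinarith
  calc _ = D ^ l * (Real.exp (-θ * r) ^ ⌈Real.log M / r⌉₊ * (M : ℝ) ^ θ) := by ring
    _ ≤ D ^ l * 1 := by gcongr
    _ = _ := mul_one _

/-- The expected running time is at least the one that the capacity allows. -/
lemma log_le_mul_tsum {ε p r : ℝ} (hε : ε ∈ Icc (0 : ℝ) 1) (hr : 0 ≤ r)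
    (h : ∀ a ∈ Icc (0 : ℝ) 1, reward ε r a ≤ r) {l M : ℕ} (hM : 0 < M)
    (hs : Summable (runningProb ε p l M)) :
    Real.log M ≤ r * ∑' n, runningProb ε p l M n := by
  have h1 : Tendsto (fun n => (Real.log M + r) * runningProb ε p l M n +
      r * ∑ i ∈ Finset.range n, runningProb ε p l M i) atTop
      (𝓝 ((Real.log M + r) * 0 + r * ∑' n, runningProb ε p l M n)) :=
    (hs.tendsto_atTop_zero.const_mul _).add (hs.hasSum.tendsto_sum_nat.const_mul r)
  rw [mul_zero, zero_add] at h1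
  exact ge_of_tendsto' h1 fun n => log_le_runningProb hε hr h l hM n

/-- M^θ grows like e^{θnR log 2}, which the decay e^{-θrn} of the running probability outweighs. -/
lemma tendsto_errorProb_schemeCode {ε p r R : ℝ} (hε : ε ∈ Icc (0 : ℝ) 1) (hε1 : ε < 1)
    (hp : p ∈ Icc (0 : ℝ) (1 / 2)) (hp0 : 0 < p) (hr : 0 < r) (hR : 0 ≤ R)
    (hRr : R * Real.log 2 < r) (h : r < (1 - ε) * (Real.binEntropy p - p * r)) :
    ∃ l₀ : ℕ, ∀ l ≥ l₀,
      Tendsto (fun n : ℕ => errorProb ε (schemeCode p l (numMessages n R) n)) atTop (𝓝 0) := by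
  obtain ⟨θ, hθ, D, hD, l₀, hl₀⟩ := exists_runningProb_le hε hε1 hp hp0 hr h
  refine ⟨l₀, fun l hl => ?_⟩
  set x := Real.exp (-θ * (r - R * Real.log 2)) with hx
  have hx1 : x < 1 := Real.exp_lt_one_iff.2 (by nlinarith)
  have hlim : Tendsto (fun n : ℕ => D ^ l * 2 ^ θ * x ^ n) atTop (𝓝 (D ^ l * 2 ^ θ * 0)) :=
    (tendsto_pow_atTop_nhds_zero_of_lt_one (Real.exp_pos _).le hx1).const_mul _
  rw [mul_zero] at hlim
  refine squeeze_zero (fun n => ?_) (fun n => ?_) hlim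
  · refine div_nonneg (Finset.sum_nonneg fun m _ => Finset.sum_nonneg fun y _ => ?_)
      (Nat.cast_nonneg _)
    split_ifs
    · exact le_rfl
    · change 0 ≤ law ε (schemeEnc p l (numMessages n R) n) m y
      rw [← truncate_schemeStream, law_truncate]
      split_ifs
      exacts [weight_nonneg hε y, le_rfl]
  · refine (errorProb_le_runningProb hε p l _ n).trans ((hl₀ l hl _ (NeZero.pos _) n).trans ?_)
    have h1 : (numMessages n R : ℝ) ≤ 2 * 2 ^ ((n : ℝ) * R) := by
      have h2 : (1 : ℝ) ≤ 2 ^ ((n : ℝ) * R) :=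
        Real.one_le_rpow one_le_two (by positivity)
      have := (Nat.ceil_lt_add_one (zero_le_one.trans h2)).le
      unfold numMessages
      linarith
    have h3 : (numMessages n R : ℝ) ^ θ ≤ 2 ^ θ * Real.exp (n * (θ * (R * Real.log 2))) := by
      refine (Real.rpow_le_rpow (Nat.cast_nonneg _) h1 hθ.le).trans_eq ?_
      rw [Real.mul_rpow two_pos.le (by positivity), ← Real.rpow_mul two_pos.le,
        Real.rpow_def_of_pos two_pos (_ * _)]
      congr 2
      ring
    calc _ ≤ Real.exp (-θ * r) ^ n *
          (D ^ l * (2 ^ θ * Real.exp (n * (θ * (R * Real.log 2))))) := by gcongr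
      _ = D ^ l * 2 ^ θ * (Real.exp (n * (-θ * r)) * Real.exp (n * (θ * (R * Real.log 2)))) := by
        rw [← Real.exp_nat_mul]; ring
      _ = _ := by
        rw [← Real.exp_add, hx, ← Real.exp_nat_mul]
        congr 2
        ring

/-! ### The capacity -/

lemma rateFun_zero (ε : ℝ) : rateFun ε 0 = 0 := by
  simp [rateFun, binEntropy₂]

/-- A maximum of the rate function, in nats, bounds the reward. -/
lemma reward_le_of_isMaxOn {ε p : ℝ} (hε : ε ∈ Icc (0 : ℝ) 1)
    (hmax : IsMaxOn (rateFun ε) (Icc 0 (1 / 2)) p) :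
    ∀ a ∈ Icc (0 : ℝ) 1, reward ε (rateFun ε p * Real.log 2) a ≤ rateFun ε p * Real.log 2 := by
  have hlog2 : 0 < Real.log 2 := Real.log_pos one_lt_two
  have hC : 0 ≤ rateFun ε p := by
    have := hmax (show (0 : ℝ) ∈ Icc (0 : ℝ) (1 / 2) by constructor <;> norm_num)
    simpa [rateFun_zero] using this
  rcases hε.2.eq_or_lt with rfl | hε1
  · intro a _
    simp [reward, rateFun]
  have hε' : 0 < 1 - ε := by linarith
  have half : ∀ a ∈ Icc (0 : ℝ) (1 / 2),
      reward ε (rateFun ε p * Real.log 2) a ≤ rateFun ε p * Real.log 2 := by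
    intro a ha
    have h1 : rateFun ε a ≤ rateFun ε p := hmax ha
    have hden : 0 < a + 1 / (1 - ε) := add_pos_of_nonneg_of_pos ha.1 (by positivity)
    have h2 : rateFun ε a = Real.binEntropy a / Real.log 2 / (a + 1 / (1 - ε)) := by
      rw [rateFun, if_neg hε1.ne, binEntropy₂]
    rw [h2, div_le_iff₀ hden, div_le_iff₀ hlog2] at h1
    have h3 := mul_le_mul_of_nonneg_left h1 hε'.le
    have h4 : (1 - ε) * (rateFun ε p * (a + 1 / (1 - ε)) * Real.log 2) =
        (1 - ε) * (a * (rateFun ε p * Real.log 2)) + rateFun ε p * Real.log 2 := by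
      field_simp
    unfold reward
    linarith
  intro a ha
  -- For a ≥ 1/2, replacing a by 1 - a keeps the entropy and sends fewer ones, so the maximum over
  -- [0, 1/2] suffices.
  rcases le_total a (1 / 2) with h | h
  · exact half a ⟨ha.1, h⟩
  · refine le_trans ?_ (half (1 - a) ⟨by linarith [ha.2], by linarith⟩)
    unfold reward
    rw [Real.binEntropy_one_sub]
    gcongr
    linarith

lemma exists_isMaxOn_rateFun {ε : ℝ} (hε : ε ∈ Icc (0 : ℝ) 1) :
    ∃ p ∈ Icc (0 : ℝ) (1 / 2), IsMaxOn (rateFun ε) (Icc 0 (1 / 2)) p := by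
  refine isCompact_Icc.exists_isMaxOn ⟨0, by constructor <;> norm_num⟩ ?_
  rcases hε.2.eq_or_lt with rfl | hε1
  · rw [show rateFun 1 = fun _ => 0 from funext fun a => if_pos rfl]
    exact continuousOn_const
  · rw [show rateFun ε = fun a => Real.binEntropy a / Real.log 2 / (a + 1 / (1 - ε)) from
      funext fun a => if_neg hε1.ne]
    refine ContinuousOn.div (Real.binEntropy_continuous.div_const _).continuousOn
      (by fun_prop) fun a ha => ?_
    have : 0 < 1 - ε := by linarith
    have := ha.1
    positivity

lemma isMaxOn_pos {ε p : ℝ} (hε1 : ε < 1) (hmax : IsMaxOn (rateFun ε) (Icc 0 (1 / 2)) p) :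
    0 < rateFun ε p := by
  have h1 : rateFun ε (1 / 2) ≤ rateFun ε p :=
    hmax (show (1 / 2 : ℝ) ∈ Icc (0 : ℝ) (1 / 2) by constructor <;> norm_num)
  refine lt_of_lt_of_le ?_ h1
  have : 0 < 1 - ε := by linarith
  have hent : 0 < Real.binEntropy (1 / 2) := Real.binEntropy_pos (by norm_num) (by norm_num)
  have hlog2 : 0 < Real.log 2 := Real.log_pos one_lt_two
  rw [rateFun, if_neg hε1.ne, binEntropy₂]
  positivity

lemma pos_of_rateFun_pos {ε p : ℝ} (hp : 0 ≤ p) (h : 0 < rateFun ε p) : 0 < p := by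
  refine hp.lt_of_ne ?_
  rintro rfl
  exact h.ne' (rateFun_zero ε)

/-- Rates below the value of the rate function, in nats, are exceeded by the reward. -/
lemma lt_reward_of_lt {ε p r : ℝ} (hε1 : ε < 1) (hp : 0 ≤ p)
    (h : r < rateFun ε p * Real.log 2) :
    r < (1 - ε) * (Real.binEntropy p - p * r) := by
  have hlog2 : 0 < Real.log 2 := Real.log_pos one_lt_two
  have hε' : 0 < 1 - ε := by linarith
  have hden : 0 < p + 1 / (1 - ε) := add_pos_of_nonneg_of_pos hp (by positivity)
  rw [rateFun, if_neg hε1.ne, binEntropy₂, div_mul_eq_mul_div, div_mul_cancel₀ _ hlog2.ne',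
    lt_div_iff₀ hden] at h
  have h2 := mul_lt_mul_of_pos_left h hε'
  have h3 : (1 - ε) * (r * (p + 1 / (1 - ε))) = (1 - ε) * (p * r) + r := by field_simp
  linarith

/-- With a single message no error is possible. This makes the set of achievable rates nonempty and
its upper bounds nonnegative, which settles ε = 1. -/
lemma achievable_zero (ε : ℝ) : Achievable ε 0 := by
  refine ⟨le_rfl, fun n => schemeCode 0 0 _ n, fun n => isRLL_schemeEnc _ _ _ _, ?_⟩
  have : ∀ n : ℕ, errorProb ε (schemeCode 0 0 (numMessages n 0) n) = 0 := by
    intro n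
    have hn : numMessages n 0 = 1 := by simp [numMessages]
    have : Subsingleton (Fin (numMessages n 0)) := by rw [hn]; infer_instance
    rw [errorProb, Finset.sum_eq_zero, zero_div]
    exact fun m _ => Finset.sum_eq_zero fun y _ => if_pos (Subsingleton.elim _ _)
  simp [this]

lemma exists_tendsto_errorProb {ε p R : ℝ} (hε : ε ∈ Icc (0 : ℝ) 1) (hε1 : ε < 1)
    (hp : p ∈ Icc (0 : ℝ) (1 / 2)) (hR : 0 ≤ R) (hRC : R < rateFun ε p) :
    ∃ l₀ : ℕ, ∀ l ≥ l₀,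
      Tendsto (fun n : ℕ => errorProb ε (schemeCode p l (numMessages n R) n)) atTop (𝓝 0) := by
  have hlog2 : 0 < Real.log 2 := Real.log_pos one_lt_two
  obtain ⟨r, h1, h2⟩ := exists_between (mul_lt_mul_of_pos_right hRC hlog2)
  exact tendsto_errorProb_schemeCode hε hε1 hp (pos_of_rateFun_pos hp.1 (hR.trans_lt hRC))
    ((by positivity : 0 ≤ R * Real.log 2).trans_lt h1) hR h1 (lt_reward_of_lt hε1 hp.1 h2)

/-- The supremum of the achievable rates is the maximum of the rate function. -/
theorem isLUB_achievable {ε p : ℝ} (hε : ε ∈ Icc (0 : ℝ) 1) (hp : p ∈ Icc (0 : ℝ) (1 / 2))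
    (hmax : IsMaxOn (rateFun ε) (Icc 0 (1 / 2)) p) :
    IsLUB {R | Achievable ε R} (rateFun ε p) := by
  have hlog2 : 0 < Real.log 2 := Real.log_pos one_lt_two
  constructor
  · intro R hR
    exact le_of_mul_le_mul_right (hR.mul_log_two_le hε (reward_le_of_isMaxOn hε hmax)) hlog2
  · intro B hB
    have hB0 : 0 ≤ B := hB (achievable_zero ε)
    rcases hε.2.eq_or_lt with rfl | hε1
    · simpa [rateFun] using hB0
    by_contra! hlt
    obtain ⟨R, h1, h2⟩ := exists_between hlt
    obtain ⟨l, hl⟩ := exists_tendsto_errorProb hε hε1 hp (hB0.trans h1.le) h2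
    have : Achievable ε R := ⟨hB0.trans h1.le, fun n => schemeCode p l _ n,
      fun n => isRLL_schemeEnc _ _ _ _, hl l le_rfl⟩
    exact absurd (hB this) (not_le.2 h1)

theorem feedbackCapacity_eq {ε p : ℝ} (hε : ε ∈ Icc (0 : ℝ) 1) (hp : p ∈ Icc (0 : ℝ) (1 / 2))
    (hmax : IsMaxOn (rateFun ε) (Icc 0 (1 / 2)) p) : feedbackCapacity ε = rateFun ε p :=
  (isLUB_achievable hε hp hmax).csSup_eq ⟨0, achievable_zero ε⟩

/-- The number of bits per expected channel use tends to the capacity. -/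
theorem exists_rate_close {ε p δ : ℝ} (hε : ε ∈ Icc (0 : ℝ) 1) (hε1 : ε < 1)
    (hp : p ∈ Icc (0 : ℝ) (1 / 2)) (hmax : IsMaxOn (rateFun ε) (Icc 0 (1 / 2)) p) (hδ : 0 < δ) :
    ∃ l₀ : ℕ, ∀ l ≥ l₀, (∀ M : ℕ, expectedUses ε p l M ≠ ⊤) ∧
      ∀ᶠ M : ℕ in atTop,
        |Real.logb 2 M / (expectedUses ε p l M).toReal - rateFun ε p| < δ := by
  have hlog2 : 0 < Real.log 2 := Real.log_pos one_lt_two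
  have hC := isMaxOn_pos hε1 hmax
  -- The Chernoff bound needs a positive rate strictly below capacity; `c` lies within δ of it.
  obtain ⟨c, hc1, hc2⟩ := exists_between (show max 0 (rateFun ε p - δ) < rateFun ε p from
    max_lt hC (by linarith))
  have hc0 : 0 < c := (le_max_left _ _).trans_lt hc1
  have hcδ : rateFun ε p - δ < c := (le_max_right _ _).trans_lt hc1
  have hr : 0 < c * Real.log 2 := by positivity
  obtain ⟨θ, hθ, D, hD, l₀, hl₀⟩ := exists_runningProb_le hε hε1 hp (pos_of_rateFun_pos hp.1 hC) hr
    (lt_reward_of_lt hε1 hp.1 (mul_lt_mul_of_pos_right hc2 hlog2))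
  refine ⟨l₀, fun l hl => ?_⟩
  have key := fun (M : ℕ) (hM : 0 < M) => expectedUses_le (p := p) hε hr hθ hD hM (hl₀ l hl M hM)
  refine ⟨fun M => ?_, ?_⟩
  · rcases Nat.eq_zero_or_pos M with rfl | hM
    · simp [expectedUses, runningProb_zero_messages]
    · rw [expectedUses_eq hε (key M hM).1]
      exact ENNReal.ofReal_ne_top
  · set K := 1 + D ^ l / (1 - Real.exp (-θ * (c * Real.log 2))) with hK
    have hlim : Tendsto (fun M : ℕ => Real.log M) atTop atTop :=
      Real.tendsto_log_atTop.comp tendsto_natCast_atTop_atTop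
    -- From E[T] ≤ log M / (c log 2) + K, the rate exceeds C - δ once log M (1 - (C - δ)/c) outgrows
    -- the constant (C - δ) K log 2.
    have hlim2 : Tendsto (fun M : ℕ => Real.log M * (1 - (rateFun ε p - δ) / c)) atTop atTop :=
      hlim.atTop_mul_const (by rw [sub_pos, div_lt_one hc0]; exact hcδ)
    filter_upwards [hlim2.eventually_gt_atTop ((rateFun ε p - δ) * Real.log 2 * K),
      eventually_ge_atTop 2] with M hM1 hM2
    have hM : 0 < M := by omega
    obtain ⟨hs, hle⟩ := key M hM
    have hlow := log_le_mul_tsum hε (by positivity) (reward_le_of_isMaxOn hε hmax) hM hs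
    rw [expectedUses_eq hε hs, ENNReal.toReal_ofReal (tsum_nonneg (runningProb_nonneg hε p l M))]
    set T := ∑' n, runningProb ε p l M n with hT
    have hlogM : 0 < Real.log M := Real.log_pos (by exact_mod_cast hM2)
    have hT0 : 0 < T := by
      by_contra! hneg
      have : rateFun ε p * Real.log 2 * T ≤ 0 :=
        mul_nonpos_of_nonneg_of_nonpos (by positivity) hneg
      linarith
    rw [abs_lt, Real.logb, div_div]
    have hden : 0 < Real.log 2 * T := by positivity
    constructor
    · suffices rateFun ε p - δ < Real.log M / (Real.log 2 * T) by linarith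
      rw [lt_div_iff₀ hden]
      rcases le_or_gt (rateFun ε p - δ) 0 with h0 | h0
      · exact (mul_nonpos_of_nonpos_of_nonneg h0 hden.le).trans_lt hlogM
      · calc _ ≤ (rateFun ε p - δ) * (Real.log 2 * (Real.log M / (c * Real.log 2) + K)) := by
              gcongr
              linarith
          _ = Real.log M * ((rateFun ε p - δ) / c) + (rateFun ε p - δ) * Real.log 2 * K := by
              field_simp
          _ < Real.log M := by linarith
    · suffices Real.log M / (Real.log 2 * T) ≤ rateFun ε p by linarith
      rw [div_le_iff₀ hden]
      linarith

end

end ErasureRLL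

theorem theorem1 (ε : ℝ) (hε : ε ∈ Set.Icc (0 : ℝ) 1) :
    -- the capacity formula
    (IsLUB {R | ErasureRLL.Achievable ε R} (ErasureRLL.feedbackCapacity ε) ∧
      IsGreatest (ErasureRLL.rateFun ε '' Set.Icc 0 (1 / 2)) (ErasureRLL.feedbackCapacity ε)) ∧
    -- the scheme respects the input constraint
    (∀ p ∈ Set.Icc (0 : ℝ) (1 / 2), ∀ l M n : ℕ,
      ErasureRLL.IsRLL (ErasureRLL.schemeEnc p l M n)) ∧
    -- the scheme has zero error
    (∀ p ∈ Set.Icc (0 : ℝ) (1 / 2), ∀ (l M : ℕ) [NeZero M] (n : ℕ) (m : Fin M)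
      (y : Fin n → ErasureRLL.Output),
      ErasureRLL.law ε (ErasureRLL.schemeEnc p l M n) m y ≠ 0 →
      (ErasureRLL.run p l M y).phase = ErasureRLL.Phase.done →
      ErasureRLL.schemeDec p l M y = m) ∧
    -- the scheme achieves the capacity
    (ε < 1 → ∀ p ∈ Set.Icc (0 : ℝ) (1 / 2),
      IsMaxOn (ErasureRLL.rateFun ε) (Set.Icc 0 (1 / 2)) p →
      (∀ δ > 0, ∃ l₀ : ℕ, ∀ l ≥ l₀,
        (∀ M : ℕ, ErasureRLL.expectedUses ε p l M ≠ ⊤) ∧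
        ∀ᶠ M : ℕ in Filter.atTop,
          |Real.logb 2 M / (ErasureRLL.expectedUses ε p l M).toReal -
            ErasureRLL.feedbackCapacity ε| < δ) ∧
      (∀ R : ℝ, 0 ≤ R → R < ErasureRLL.feedbackCapacity ε → ∃ l₀ : ℕ, ∀ l ≥ l₀,
        Filter.Tendsto
          (fun n : ℕ => ErasureRLL.errorProb ε
            (ErasureRLL.schemeCode p l (ErasureRLL.numMessages n R) n))
          Filter.atTop (nhds 0))) := by
  obtain ⟨p₀, hp₀, hmax₀⟩ := ErasureRLL.exists_isMaxOn_rateFun hε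
  have hcap := ErasureRLL.feedbackCapacity_eq hε hp₀ hmax₀
  refine ⟨⟨?_, ?_⟩, fun p _ l M n => ErasureRLL.isRLL_schemeEnc p l M n,
    fun p _ l M _ n m y hlaw h => ErasureRLL.schemeDec_eq_of_done hlaw h, fun hε1 p hp hmax => ?_⟩
  · rw [hcap]
    exact ErasureRLL.isLUB_achievable hε hp₀ hmax₀
  · rw [hcap]
    refine ⟨Set.mem_image_of_mem _ hp₀, ?_⟩
    rintro _ ⟨a, ha, rfl⟩
    exact hmax₀ ha
  · rw [ErasureRLL.feedbackCapacity_eq hε hp hmax]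
    exact ⟨fun δ hδ => ErasureRLL.exists_rate_close hε hε1 hp hmax hδ,
      fun R hR hRC => ErasureRLL.exists_tendsto_errorProb hε hε1 hp hR hRC⟩
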